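/- Let $k$ be a commutative artinian ring and $A$ an artin $k$-algebra (a $k$-algebra that is finitely generated as a $k$-module); modules are left modules. Assume that $A$ is a cyclic Nakayama algebra: $A$ is connected (nonzero and not a product of two nonzero algebras), every (finitely generated) indecomposable $A$-module is serial (has a unique composition series), and no simple $A$-module is projective. For a module $M$ let $PM$ be its projective cover and $IM$ its injective envelope; let $\tau = D\operatorname{Tr}$ and $\tau^- = \operatorname{Tr} D$ be the Auslander–Reiten translations. For a simple module $S$ put $$\psi S = \tau^-\operatorname{top} IS, \qquad \gamma S = \tau \operatorname{soc} PS .$$ Then $\operatorname{top} IS$ is never injective and $\operatorname{soc} PS$ is never projective, and $\psi$ and $\gamma$ are well-defined maps from the set of isomorphism classes of simple $A$-modules to itself. Let $a(S)$ (respectively $a'(S)$) be the supremum in $\mathbb N\cup\{\infty\}$ of the numbers $m$ such that there is a sequence $(S_1,\dots,S_m)$ of simple modules with $S_m = S$ and $S_{i+1}=\psi S_i$ (respectively $S_{i+1}=\gamma S_i$) for $1\le i<m$. Call $S$ $\psi$-cyclic if $a(S)=\infty$, and $\gamma$-cyclic if $a'(S)=\infty$. Let $a(A)$ be the maximum of $a(S)$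 over the simple modules $S$ that are not $\psi$-cyclic ($0$ if there are none), and let $c(A)$ be the number of isomorphism classes of $\psi$-cyclic simple $A$-modules. Then: (1) For all $t\ge 0$, $$\psi^t\gamma^t\psi^t=\psi^t \quad\text{and}\quad \gamma^t\psi^t\gamma^t=\gamma^t .$$ (2) For all $t\ge 0$, the map $\gamma^t\colon \operatorname{Im}\psi^t\to\operatorname{Im}\gamma^t$ is a bijection with inverse $\psi^t$. (3) The number $a(A)$ is finite, $a(A)=a(A^{\mathrm{op}})$, and $a(A)$ is also the maximum of $a'(S)$ over the simple modules $S$ that are not $\gamma$-cyclic ($0$ if there are none). (4) The number $c(A)$ is finite, $c(A)$ equals the number of isomorphism classes of $\gamma$-cyclic simple $A$-modules, and $c(A)=c(A^{\mathrm{op}})$. -/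

import Mathlib

universe u v

namespace CyclicNakayama

open MulOpposite

/-! ### Modules over a ring -/

section Modules

variable (R : Type*) [Ring R]

/-- A module is indecomposable if it is nonzero and not the direct sum of two nonzero submodules. -/
def IsIndecomposable (M : Type*) [AddCommGroup M] [Module R M] : Prop :=
  Nontrivial M ∧ ∀ p q : Submodule R M, IsCompl p q → p = ⊥ ∨ q = ⊥

/-- A module is serial if it has a unique composition series. -/
def IsSerial (M : Type*) [AddCommGroup M] [Module R M] : Prop :=
  ∃! s : CompositionSeries (Submodule R M), s.head = ⊥ ∧ s.last = ⊤

/-- The top `M / rad M`; here `Module.jacobson R M` is the intersection of the maximal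
submodules. -/
abbrev Top (M : Type*) [AddCommGroup M] [Module R M] : Type _ :=
  M ⧸ Module.jacobson R M

/-- The socle, that is, the sum of the simple submodules. -/
def soc (M : Type*) [AddCommGroup M] [Module R M] : Submodule R M :=
  sSup {N : Submodule R M | IsSimpleModule R N}

variable {R}

/-- `p : P → M` is a projective cover: `P` is projective, `p` is surjective, and the kernel of `p`
is superfluous. -/
structure IsProjectiveCover {P M : Type*} [AddCommGroup P] [Module R P] [AddCommGroup M]
    [Module R M] (p : P →ₗ[R] M) : Prop where
  projective : Module.Projective R P
  surjective : Function.Surjective p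
  superfluous : ∀ N : Submodule R P, N ⊔ LinearMap.ker p = ⊤ → N = ⊤

/-- `i : M → I` is an injective envelope: `I` is injective, `i` is injective, and the image of `i`
is essential. -/
structure IsInjectiveEnvelope {M I : Type*} [AddCommGroup M] [Module R M] [AddCommGroup I]
    [Module R I] (i : M →ₗ[R] I) : Prop where
  isInjective : Module.Injective R I
  injective : Function.Injective i
  essential : ∀ N : Submodule R I, N ⊓ LinearMap.range i = ⊥ → N = ⊥

end Modules

/-! ### Cyclic Nakayama algebras -/

section Nakayama

variable (A : Type u) [Ring A]

/-- Connected: `A` is nonzero and not a product of two nonzero rings. -/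
def IsConnectedRing : Prop :=
  Nontrivial A ∧ ∀ e ∈ Set.center A, IsIdempotentElem e → e = 0 ∨ e = 1

/-- All (finitely generated) indecomposable left modules are serial. -/
def IsNakayama : Prop :=
  ∀ M : ModuleCat.{u} A, Module.Finite A M → IsIndecomposable A M → IsSerial A M

/-- A cyclic Nakayama algebra: connected, Nakayama, and without a simple projective module. -/
structure IsCyclicNakayama : Prop where
  connected : IsConnectedRing A
  nakayama : IsNakayama A
  no_simple_projective : ∀ M : ModuleCat.{u} A, IsSimpleModule A M → ¬ Module.Projective A M

/-- Simple left `A`-modules. -/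
def SimpleMod : Type (u + 1) := {M : ModuleCat.{u} A // IsSimpleModule A M}

instance SimpleMod.setoid : Setoid (SimpleMod A) where
  r M N := Nonempty (M.1 ≃ₗ[A] N.1)
  iseqv :=
    { refl := fun M => ⟨LinearEquiv.refl A M.1⟩
      symm := fun ⟨e⟩ => ⟨e.symm⟩
      trans := fun ⟨e⟩ ⟨f⟩ => ⟨e.trans f⟩ }

/-- The set of isomorphism classes of simple left `A`-modules. -/
def SimpleClass : Type (u + 1) := Quotient (SimpleMod.setoid A)

/-- The isomorphism class of a simple module. -/
def SimpleMod.cls {A : Type u} [Ring A] (M : SimpleMod A) : SimpleClass A :=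
  Quotient.mk (SimpleMod.setoid A) M

end Nakayama

/-! ### The duality `D`, the transpose `Tr`, and the Auslander-Reiten translations -/

section Duality

variable (k : Type v) [CommRing k]

/-- The module `Hom_k(M, E)` for a module `M` over a `k`-algebra `B`. -/
def Dual (B : Type*) [Ring B] [Algebra k B] (E : Type*) [AddCommGroup E] [Module k E]
    (M : Type*) [AddCommGroup M] [Module B M] : Type _ :=
  RestrictScalars k B M →ₗ[k] E

namespace Dual

variable (E : Type*) [AddCommGroup E] [Module k E]

instance (B : Type*) [Ring B] [Algebra k B] (M : Type*) [AddCommGroup M] [Module B M] :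
    AddCommGroup (Dual k B E M) :=
  inferInstanceAs (AddCommGroup (RestrictScalars k B M →ₗ[k] E))

/-- Multiplication by `b : B` on `M`, as a `k`-linear map. -/
def mulMap (B : Type*) [Ring B] [Algebra k B] (M : Type*) [AddCommGroup M] [Module B M] (b : B) :
    RestrictScalars k B M →ₗ[k] RestrictScalars k B M where
  toFun m := (RestrictScalars.addEquiv k B M).symm (b • RestrictScalars.addEquiv k B M m)
  map_add' x y := by simp
  map_smul' c x := by
    apply (RestrictScalars.addEquiv k B M).injective
    simp only [RestrictScalars.addEquiv_map_smul, AddEquiv.apply_symm_apply, RingHom.id_apply,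
      smul_smul, Algebra.commutes c b]

/-- If `M` is a left module, then `Hom_k(M, E)` is a right module by `(f b)(m) = f(b m)`. -/
instance left (B : Type*) [Ring B] [Algebra k B] (M : Type*) [AddCommGroup M] [Module B M] :
    Module Bᵐᵒᵖ (Dual k B E M) where
  smul b f := LinearMap.comp f (mulMap k B M (unop b))
  one_smul f := by
    apply LinearMap.ext; intro m
    change f.toFun _ = f.toFun _
    simp [mulMap]
  mul_smul a b f := by
    apply LinearMap.ext; intro m
    change f.toFun _ = f.toFun _
    simp [mulMap, mul_smul]
  smul_zero b := rfl
  smul_add b f g := rfl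
  add_smul a b f := by
    apply LinearMap.ext; intro m
    change f.toFun _ = f.toFun _ + f.toFun _
    rw [← f.map_add']
    simp [mulMap, add_smul]
  zero_smul f := by
    apply LinearMap.ext; intro m
    change f.toFun _ = 0
    have h : mulMap k B M (unop 0) m = 0 := by simp [mulMap]
    rw [h]
    exact LinearMap.map_zero (show RestrictScalars k B M →ₗ[k] E from f)

/-- If `M` is a right module, then `Hom_k(M, E)` is a left module by `(a f)(m) = f(m a)`. -/
instance right (A : Type*) [Ring A] [Algebra k A] (M : Type*) [AddCommGroup M] [Module Aᵐᵒᵖ M] :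
    Module A (Dual k Aᵐᵒᵖ E M) :=
  Module.compHom (Dual k Aᵐᵒᵖ E M) (RingEquiv.opOp A).toRingHom

end Dual

/-- `E` is an injective envelope of the `k`-module `k / rad k`. The functor `D = Hom_k(-, E)` is
the standard duality for artin `k`-algebras when `k` is a commutative artinian ring. -/
def IsDualizing (E : Type v) [AddCommGroup E] [Module k E] : Prop :=
  ∃ i : (k ⧸ Ring.jacobson k) →ₗ[k] E, IsInjectiveEnvelope i

/-- The cokernel of `Hom_B(P₀, A) → Hom_B(P₁, A)`, for `q : P₁ → ker p` followed by the
inclusion `ker p ⊆ P₀`. If `p : P₀ → X` and `q` are projective covers, then `P₁ → P₀ → X → 0` is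
a minimal projective presentation and the cokernel is the transpose `Tr X`. Either `X` is a left
module (`B = A`, `C = Aᵐᵒᵖ`) or a right module (`B = Aᵐᵒᵖ`, `C = A`), and `Tr X` is a
`C`-module. -/
abbrev Tr (A B C : Type*) [Ring A] [Ring B] [Ring C] [Module B A] [Module C A]
    [SMulCommClass B C A] {X P₀ P₁ : Type*} [AddCommGroup X] [Module B X] [AddCommGroup P₀]
    [Module B P₀] [AddCommGroup P₁] [Module B P₁]
    (p : P₀ →ₗ[B] X) (q : P₁ →ₗ[B] LinearMap.ker p) : Type _ :=
  (P₁ →ₗ[B] A) ⧸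
    LinearMap.range (LinearMap.lcomp C A ((LinearMap.ker p).subtype ∘ₗ q))

variable {A : Type u} [Ring A] [Algebra k A]

/-- `N ≅ τ M = D Tr M` for left modules `M`, `N`. -/
def IsTau (M N : Type u) [AddCommGroup M] [Module A M] [AddCommGroup N] [Module A N] : Prop :=
  ∃ (E : ModuleCat.{v} k) (P₀ P₁ : ModuleCat.{u} A) (p : P₀ →ₗ[A] M)
    (q : P₁ →ₗ[A] LinearMap.ker p),
    IsDualizing k E ∧ IsProjectiveCover p ∧ IsProjectiveCover q ∧
      Nonempty (N ≃ₗ[A] Dual k Aᵐᵒᵖ E (Tr A A Aᵐᵒᵖ p q))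

/-- `N ≅ τ⁻ M = Tr D M` for left modules `M`, `N`. -/
def IsTauInv (M N : Type u) [AddCommGroup M] [Module A M] [AddCommGroup N] [Module A N] : Prop :=
  ∃ (E : ModuleCat.{v} k) (P₀ P₁ : ModuleCat.{u} Aᵐᵒᵖ) (p : P₀ →ₗ[Aᵐᵒᵖ] Dual k A E M)
    (q : P₁ →ₗ[Aᵐᵒᵖ] LinearMap.ker p),
    IsDualizing k E ∧ IsProjectiveCover p ∧ IsProjectiveCover q ∧
      Nonempty (N ≃ₗ[A] Tr A Aᵐᵒᵖ A p q)

/-! ### The maps `ψ` and `γ` -/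

/-- `ψ S` is defined and equal to `T`: with `I` an injective envelope of `S`, the module `top I`
is not injective and `T ≅ τ⁻ (top I)`. -/
def IsPsi (S T : SimpleClass A) : Prop :=
  ∃ (M N : SimpleMod A) (I : ModuleCat.{u} A) (i : M.1 →ₗ[A] I),
    M.cls = S ∧ N.cls = T ∧ IsInjectiveEnvelope i ∧
      ¬ Module.Injective A (Top A I) ∧ IsTauInv k (A := A) (Top A I) N.1

/-- `γ S` is defined and equal to `T`: with `P` a projective cover of `S`, the module `soc P`
is not projective and `T ≅ τ (soc P)`. -/
def IsGamma (S T : SimpleClass A) : Prop :=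
  ∃ (M N : SimpleMod A) (P : ModuleCat.{u} A) (p : P →ₗ[A] M.1),
    M.cls = S ∧ N.cls = T ∧ IsProjectiveCover p ∧
      ¬ Module.Projective A (soc A P) ∧ IsTau k (A := A) (soc A P) N.1

/-- The supremum of the cardinalities of the `r`-paths `(S₁, …, S_m)` ending in `S`, where
`r S_i S_{i+1}` for `1 ≤ i < m`. -/
noncomputable def pathSup {X : Type*} (r : X → X → Prop) (S : X) : ℕ∞ :=
  ⨆ (l : List X) (_ : l.IsChain r ∧ l.getLast? = some S), (l.length : ℕ∞)

/-- `a(S)`: the supremum of the cardinalities of the `ψ`-paths ending in `S`. -/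
noncomputable def aSimple (S : SimpleClass A) : ℕ∞ := pathSup (IsPsi k) S

/-- `a'(S)`: the supremum of the cardinalities of the `γ`-paths ending in `S`. -/
noncomputable def aSimple' (S : SimpleClass A) : ℕ∞ := pathSup (IsGamma k) S

variable (A)

/-- The set of `ψ`-cyclic simple modules. -/
def psiCyclic : Set (SimpleClass A) := {S | aSimple k S = ⊤}

/-- The set of `γ`-cyclic simple modules. -/
def gammaCyclic : Set (SimpleClass A) := {S | aSimple' k S = ⊤}

/-- `a(A)`: the maximum of `a(S)`, where `S` is simple and not `ψ`-cyclic (`0` if there is no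
such `S`). -/
noncomputable def aAlg : ℕ∞ := ⨆ S ∈ (psiCyclic k A)ᶜ, aSimple k S

/-- The maximum of `a'(S)`, where `S` is simple and not `γ`-cyclic (`0` if there is no
such `S`). -/
noncomputable def aAlg' : ℕ∞ := ⨆ S ∈ (gammaCyclic k A)ᶜ, aSimple' k S

/-- `c(A)`: the number of `ψ`-cyclic simple modules. -/
noncomputable def cAlg : ℕ∞ := (psiCyclic k A).encard

/-- The number of `γ`-cyclic simple modules. -/
noncomputable def cAlg' : ℕ∞ := (gammaCyclic k A).encard

end Duality

end CyclicNakayama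

/-! For a simple module S, the modules PS and IS are uniserial; let p(S) and q(S) be their lengths.
Sending S to the top of rad PS defines a permutation τ of the finite set of simple classes
(`translation`), and a uniserial module of finite length with top S has composition factors S, τS,
τ²S, ... from the top down. It is a quotient of PS and a submodule of the injective envelope of its
socle. So a uniserial module of length m + 1 with top S and socle τ^m S exists iff m < p(S), and
also iff m < q(τ^m S). This equivalence, `lt_projLen_iff_lt_injLen`, is all that the combinatorics
needs to know about p and q, besides their positivity.

On simple modules the Auslander-Reiten translation is this τ (`isTau_iff`, `isTauInv_iff`). Indeed,
if P₁ → P₀ → M → 0 is a minimal presentation of a simple M, the maps P₁ → A that factor through P₀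
are exactly those with image in rad A (`mem_range_lcomp_iff_jacobson`). Hence Tr M is simple, and
comparing annihilators identifies D Tr M with the top of rad PM. The inverse translation is obtained
by the same argument over the opposite algebra, to which Matlis duality transfers all hypotheses.
Consequently γS = τ^{p(S)} S and ψS = τ^{-q(S)} S.

Fix x and index its τ-orbit by the integers. Then γ and ψ lift to a ↦ a + p(τ^a x) and b ↦ b - q(τ^b
x), and the equivalence above says that these lifts form a Galois connection on ℤ. So do their t-th
iterates, and the identities l u l = l and u l u = u give (1), hence (2).

For (3) and (4), n < a(S) means that S lies in Im ψ^n. Therefore a(A) and c(A) depend only on the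
cardinalities of the sets Im ψ^n (`lt_maxPath_iff`, `exists_cyclicPoints_eq`). By (2) these agree
with those of Im γ^n, and D conjugates γ into the map ψ of the opposite algebra. -/

namespace CyclicNakayama

/-! ### Serial and uniserial modules -/

section General

/-- A module is uniserial if its submodules form a chain. -/
def IsUniserial (R M : Type*) [Ring R] [AddCommGroup M] [Module R M] : Prop :=
  ∀ N N' : Submodule R M, N ≤ N' ∨ N' ≤ N

variable {R : Type*} [Ring R] {M N : Type*} [AddCommGroup M] [Module R M] [AddCommGroup N]
  [Module R N]

theorem IsUniserial.of_injective (h : IsUniserial R N) (f : M →ₗ[R] N)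
    (hf : Function.Injective f) : IsUniserial R M := fun K L =>
  (h (K.map f) (L.map f)).imp (Submodule.map_le_map_iff_of_injective hf _ _).1
    (Submodule.map_le_map_iff_of_injective hf _ _).1

theorem IsUniserial.of_surjective (h : IsUniserial R M) (f : M →ₗ[R] N)
    (hf : Function.Surjective f) : IsUniserial R N := fun K L =>
  (h (K.comap f) (L.comap f)).imp (Submodule.comap_le_comap_iff_of_surjective hf).1
    (Submodule.comap_le_comap_iff_of_surjective hf).1

/-- A composition series of K, followed by the preimage of one of M / K. -/
theorem exists_compositionSeries_mem (hM : IsFiniteLength R M) (K : Submodule R M) :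
    ∃ s : CompositionSeries (Submodule R M), s.head = ⊥ ∧ s.last = ⊤ ∧ K ∈ s := by
  obtain ⟨s, hs₁, hs₂⟩ := isFiniteLength_iff_exists_compositionSeries.mp
    (hM.of_surjective K.mkQ_surjective)
  obtain ⟨t, ht₁, ht₂⟩ := isFiniteLength_iff_exists_compositionSeries.mp
    (hM.of_injective K.subtype_injective)
  let s' : CompositionSeries (Submodule R M) :=
    s.map ⟨Submodule.comap K.mkQ, Submodule.comap_covBy_of_surjective K.mkQ_surjective⟩
  let t' : CompositionSeries (Submodule R M) :=
    t.map ⟨Submodule.map K.subtype, Submodule.map_covBy_of_injective K.subtype_injective⟩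
  have h1 : t'.last = K := by
    change Submodule.map K.subtype t.last = K
    rw [ht₂, Submodule.map_subtype_top]
  have h2 : s'.head = K := by
    change Submodule.comap K.mkQ s.head = K
    rw [hs₁, Submodule.comap_bot, Submodule.ker_mkQ]
  refine ⟨t'.smash s' (h1.trans h2.symm), ?_, ?_, ?_⟩
  · rw [RelSeries.head_smash]
    change Submodule.map K.subtype t.head = ⊥
    rw [ht₁, Submodule.map_bot]
  · rw [RelSeries.last_smash]
    change Submodule.comap K.mkQ s.last = ⊤
    rw [hs₂, Submodule.comap_top]
  · refine ⟨Fin.castLE (by simp) (Fin.last t'.length), ?_⟩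
    exact (RelSeries.smash_castLE (h1.trans h2.symm) _).trans h1

/-- Each submodule occurs in some composition series, hence in the unique one, whose members form a
chain. -/
theorem IsSerial.isUniserial (h : IsSerial R M) : IsUniserial R M := by
  obtain ⟨s, ⟨h1, h2⟩, h3⟩ := h
  have hM : IsFiniteLength R M := isFiniteLength_of_exists_compositionSeries ⟨s, h1, h2⟩
  have key : ∀ K : Submodule R M, K ∈ s := fun K => by
    obtain ⟨t, ht1, ht2, ht3⟩ := exists_compositionSeries_mem hM K
    rwa [← h3 t ⟨ht1, ht2⟩]
  exact fun K L => CompositionSeries.total (key K) (key L)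

end General

/-! ### Existence of projective covers and injective envelopes -/

section Existence

/-- Take N minimal in R^n among the submodules still mapping onto X. Lifting R^n → X through N and
restricting to N gives an endomorphism of N over X. Minimality makes it onto, finite length makes it
bijective, and so N is a direct summand of R^n. -/
theorem exists_isProjectiveCover {R : Type u} [Ring R] [IsArtinianRing R] (X : Type*)
    [AddCommGroup X] [Module R X] [Module.Finite R X] :
    ∃ (P : ModuleCat.{u} R) (p : P →ₗ[R] X), IsProjectiveCover p := by
  obtain ⟨n, f, hf⟩ := Module.Finite.exists_fin' R X
  obtain ⟨N, hN, hmin⟩ := (wellFounded_lt (α := Submodule R (Fin n → R))).has_min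
    {N | N ⊔ LinearMap.ker f = ⊤} ⟨⊤, by simp⟩
  have hmin' : ∀ K : Submodule R (Fin n → R), K ≤ N → K ⊔ LinearMap.ker f = ⊤ → K = N :=
    fun K hK h => by
      by_contra hne
      exact hmin K h (lt_of_le_of_ne hK hne)
  set π := f ∘ₗ N.subtype with hπ
  have hsurj : Function.Surjective π := fun x => by
    obtain ⟨y, rfl⟩ := hf x
    have hy : y ∈ N ⊔ LinearMap.ker f := by rw [hN]; trivial
    obtain ⟨a, ha, b, hb, rfl⟩ := Submodule.mem_sup.1 hy
    exact ⟨⟨a, ha⟩, by simp [hπ, LinearMap.mem_ker.1 hb]⟩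
  obtain ⟨g, hg⟩ := Module.projective_lifting_property π f hsurj
  set e : N →ₗ[R] N := g ∘ₗ N.subtype with he
  have hπe : ∀ x, π (e x) = π x := fun x => LinearMap.congr_fun hg _
  have hsupp : ∀ K : Submodule R N, K ⊔ LinearMap.ker π = ⊤ → K = ⊤ := fun K hK => by
    have := hmin' (K.map N.subtype) (Submodule.map_subtype_le N K) (by
      rw [eq_top_iff]
      intro y _
      obtain ⟨x, hx⟩ := hsurj (f y)
      have hx' : x ∈ K ⊔ LinearMap.ker π := by rw [hK]; trivial
      obtain ⟨a, ha, b, hb, rfl⟩ := Submodule.mem_sup.1 hx'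
      refine Submodule.mem_sup.2 ⟨a, ⟨a, ha, rfl⟩, y - a, ?_, by simp⟩
      rw [map_add, LinearMap.mem_ker.1 hb, add_zero] at hx
      rw [LinearMap.mem_ker, map_sub, ← hx]
      simp [hπ])
    apply Submodule.map_injective_of_injective N.subtype_injective
    rw [this, Submodule.map_subtype_top]
  have hesurj : Function.Surjective e := by
    rw [← LinearMap.range_eq_top]
    refine hsupp _ (eq_top_iff.2 fun y _ => ?_)
    exact Submodule.mem_sup.2 ⟨e y, ⟨y, rfl⟩, y - e y, by simp [hπe], by simp⟩
  have hbij : Function.Bijective e :=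
    ⟨IsNoetherian.injective_of_surjective_endomorphism e hesurj, hesurj⟩
  refine ⟨ModuleCat.of R N, π, ⟨?_, hsurj, hsupp⟩⟩
  refine Module.Projective.of_split
    (N.subtype ∘ₗ (LinearEquiv.ofBijective e hbij).symm.toLinearMap) g ?_
  ext1 x
  exact (LinearEquiv.ofBijective e hbij).apply_symm_apply x

theorem exists_maximal_inf_eq_bot {R M : Type*} [Ring R] [AddCommGroup M] [Module R M]
    (N : Submodule R M) : ∃ C : Submodule R M, C ⊓ N = ⊥ ∧ ∀ D, C ≤ D → D ⊓ N = ⊥ → D = C := by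
  obtain ⟨C, -, hC⟩ := zorn_le_nonempty₀ {C : Submodule R M | C ⊓ N = ⊥} (fun c hc hchain y hy => by
    refine ⟨sSup c, ?_, fun z hz => le_sSup hz⟩
    rw [Set.mem_ofPred_eq, eq_bot_iff]
    rintro x ⟨hx1, hx2⟩
    obtain ⟨K, hK, hxK⟩ := (Submodule.mem_sSup_of_directed ⟨y, hy⟩ hchain.directedOn).1 hx1
    rw [← show K ⊓ N = ⊥ from hc hK]
    exact ⟨hxK, hx2⟩) ⊥ (by simp)
  exact ⟨C, hC.prop, fun D hD h => (hC.eq_of_le h hD).symm⟩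

/-- Inside an injective module J containing M, a maximal essential extension N of M is a retract of
J, and is therefore injective. -/
theorem exists_isInjectiveEnvelope {R : Type u} [Ring R] (M : Type u) [AddCommGroup M]
    [Module R M] : ∃ (I : ModuleCat.{u} R) (i : M →ₗ[R] I), IsInjectiveEnvelope i := by
  obtain ⟨⟨J, hJ, jj, hj⟩⟩ := CategoryTheory.EnoughInjectives.presentation (ModuleCat.of R M)
  have hJ' : Module.Injective R J := (Module.injective_iff_injective_object R J).2 hJ
  obtain ⟨j, hj⟩ : ∃ j : M →ₗ[R] J, Function.Injective j :=
    ⟨jj.hom, (ModuleCat.mono_iff_injective _).1 hj⟩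
  obtain ⟨N, hjN, hN⟩ := zorn_le_nonempty₀ {N : Submodule R J | LinearMap.range j ≤ N ∧
      ∀ K ≤ N, K ⊓ LinearMap.range j = ⊥ → K = ⊥} (fun c hc hchain y hy => by
    refine ⟨sSup c, ⟨(hc hy).1.trans (le_sSup hy), fun K hK h => ?_⟩, fun z hz => le_sSup hz⟩
    rw [eq_bot_iff]
    intro x hx
    obtain ⟨L, hL, hxL⟩ := (Submodule.mem_sSup_of_directed ⟨y, hy⟩ hchain.directedOn).1 (hK hx)
    have := (hc hL).2 (Submodule.span R {x}) (by simpa [Submodule.span_le] using hxL)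
      (eq_bot_iff.2 <| h ▸ inf_le_inf_right _ (by simpa [Submodule.span_le] using hx))
    simpa [Submodule.span_singleton_eq_bot] using this) (LinearMap.range j)
      ⟨le_rfl, fun K hK h => by rwa [inf_eq_left.2 hK] at h⟩
  obtain ⟨-, hess⟩ := hN.prop
  obtain ⟨C, hCN, hC⟩ := exists_maximal_inf_eq_bot N
  have hinj : Function.Injective (C.mkQ ∘ₗ N.subtype) := by
    rw [← LinearMap.ker_eq_bot, eq_bot_iff]
    intro x hx
    have : (x : J) ∈ C ⊓ N := ⟨by simpa using hx, x.2⟩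
    rw [hCN] at this
    simpa using this
  -- Since N embeds in J / C, its inclusion into J extends to h : J / C → J; this will be the
  -- retraction onto N.
  obtain ⟨h, hh⟩ := Module.Injective.extension_property R J _ _ _ hinj N.subtype
  have hh' : ∀ x : N, h (C.mkQ x) = x := fun x => LinearMap.congr_fun hh x
  have hhinj : ∀ K : Submodule R J, K ⊓ N = ⊥ → K.comap (h ∘ₗ C.mkQ) = C := fun K hK => by
    refine hC _ (fun x hx => ?_) (eq_bot_iff.2 ?_)
    · rw [Submodule.mem_comap, LinearMap.comp_apply, Submodule.mkQ_apply,
        (Submodule.Quotient.mk_eq_zero C).2 hx, map_zero]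
      exact K.zero_mem
    · rintro x ⟨hx, hxN⟩
      have : h (C.mkQ x) = x := hh' ⟨x, hxN⟩
      rw [← hK]
      have hx' : h (C.mkQ x) ∈ K := hx
      exact ⟨this ▸ hx', hxN⟩
  -- By the maximality of C, the image of h is again an essential extension of M. It contains N, so
  -- the maximality of N forces equality.
  have hrange : LinearMap.range h = N := by
    refine (hN.eq_of_le (y := LinearMap.range h) ⟨?_, fun K hK hKj => ?_⟩ ?_).symm
    · exact hjN.trans fun x hx => ⟨C.mkQ x, hh' ⟨x, hx⟩⟩
    · have h1 : K ⊓ N = ⊥ := hess _ inf_le_right (eq_bot_iff.2 <| hKj ▸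
        inf_le_inf_right _ inf_le_left)
      rw [eq_bot_iff]
      intro x hx
      obtain ⟨y, rfl⟩ := hK hx
      obtain ⟨z, rfl⟩ := C.mkQ_surjective y
      have : z ∈ K.comap (h ∘ₗ C.mkQ) := hx
      rw [hhinj K h1] at this
      rw [Submodule.mkQ_apply, (Submodule.Quotient.mk_eq_zero C).2 this, map_zero]
      exact zero_mem _
    · exact fun x hx => ⟨C.mkQ x, hh' ⟨x, hx⟩⟩
  let r : J →ₗ[R] N := (h ∘ₗ C.mkQ).codRestrict N fun x => hrange ▸ ⟨C.mkQ x, rfl⟩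
  have hr : ∀ x : N, r x = x := fun x => Subtype.ext (hh' x)
  let i : M →ₗ[R] N := j.codRestrict N fun x => hjN ⟨x, rfl⟩
  refine ⟨ModuleCat.of R N, i, ⟨⟨fun X Y _ _ _ _ f hf g => ?_⟩, ?_, fun K hK => ?_⟩⟩
  · obtain ⟨g', hg'⟩ := hJ'.out f hf (N.subtype ∘ₗ g)
    exact ⟨r ∘ₗ g', fun x => by simpa [hg'] using hr (g x)⟩
  · exact fun x y hxy => hj (congrArg Subtype.val hxy)
  · have := hess (K.map N.subtype) (Submodule.map_subtype_le _ _) (eq_bot_iff.2 ?_)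
    · exact Submodule.map_injective_of_injective N.subtype_injective
        (this.trans (Submodule.map_bot _).symm)
    · rintro _ ⟨⟨x, hx, rfl⟩, ⟨y, hy⟩⟩
      have : x ∈ K ⊓ LinearMap.range i := ⟨hx, ⟨y, Subtype.ext hy⟩⟩
      rw [hK] at this
      simp [(Submodule.mem_bot R).1 this]

end Existence

/-! ### Simple modules over an artinian ring -/

section Simple

variable {R : Type*} [Ring R]

theorem equiv_of_ne_zero {S T : Type*} [AddCommGroup S] [Module R S] [AddCommGroup T] [Module R T]
    [IsSimpleModule R S] [IsSimpleModule R T] {f : S →ₗ[R] T} (hf : f ≠ 0) : Nonempty (S ≃ₗ[R] T) :=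
  ⟨LinearEquiv.ofBijective f (LinearMap.bijective_of_ne_zero hf)⟩

/-- Over an artinian ring, a simple module is determined by its annihilator. -/
theorem equiv_of_annihilator_le [IsArtinianRing R] {S T : Type*} [AddCommGroup S] [Module R S]
    [AddCommGroup T] [Module R T] [IsSimpleModule R S] [IsSimpleModule R T]
    (h : ∀ r : R, (∀ s : S, r • s = 0) → ∀ t : T, r • t = 0) : Nonempty (S ≃ₗ[R] T) := by
  classical
  let F (s : Finset S) : R →ₗ[R] (s → S) := LinearMap.pi fun x => LinearMap.toSpanSingleton R S x
  -- By the descending chain condition, finitely many elements of S already have the same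
  -- annihilator as S. Hence R / ann S embeds in a finite power of S and is semisimple; its quotient
  -- T then embeds in that power too, and some coordinate is nonzero on T.
  obtain ⟨s, hs⟩ : ∃ s : Finset S, ∀ r, r ∈ LinearMap.ker (F s) → ∀ x : S, r • x = 0 := by
    obtain ⟨_, ⟨s, rfl⟩, hmin⟩ := (wellFounded_lt (α := Submodule R R)).has_min
      (Set.range fun s => LinearMap.ker (F s)) ⟨_, ⟨∅, rfl⟩⟩
    refine ⟨s, fun r hr x => ?_⟩
    by_contra hx
    refine hmin _ ⟨insert x s, rfl⟩ (lt_of_le_of_ne (fun a ha => ?_) fun heq => ?_)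
    · rw [LinearMap.mem_ker] at ha ⊢
      ext y
      exact congrFun ha ⟨y.1, Finset.mem_insert_of_mem y.2⟩
    · have : r ∈ LinearMap.ker (F (insert x s)) := heq.ge hr
      exact hx (congrFun (LinearMap.mem_ker.1 this) ⟨x, Finset.mem_insert_self _ _⟩)
  have : Nontrivial T := IsSimpleModule.nontrivial R T
  obtain ⟨t, ht⟩ := exists_ne (0 : T)
  let g : (R ⧸ LinearMap.ker (F s)) →ₗ[R] T :=
    Submodule.liftQ _ (LinearMap.toSpanSingleton R T t) fun r hr => h r (hs r hr) t
  have hg : Function.Surjective g := fun y => by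
    obtain ⟨r, rfl⟩ := IsSimpleModule.toSpanSingleton_surjective R ht y
    exact ⟨Submodule.Quotient.mk r, rfl⟩
  let j := (LinearMap.ker (F s)).liftQ (F s) le_rfl
  have hj : Function.Injective j :=
    LinearMap.ker_eq_bot.1 (Submodule.ker_liftQ_eq_bot _ _ _ le_rfl)
  have hsemi : IsSemisimpleModule R (R ⧸ LinearMap.ker (F s)) :=
    IsSemisimpleModule.of_injective j hj
  obtain ⟨l, hl⟩ := IsSemisimpleModule.lifting_property g hg LinearMap.id
  let φ : T →ₗ[R] (s → S) := j ∘ₗ l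
  have hφ : Function.Injective φ :=
    hj.comp (Function.LeftInverse.injective (g := g) fun x => LinearMap.congr_fun hl x)
  obtain ⟨x, hx⟩ : ∃ x, φ t x ≠ 0 := by
    by_contra! hcon
    exact ht (hφ ((funext hcon).trans (map_zero φ).symm))
  obtain ⟨e⟩ := equiv_of_ne_zero (f := LinearMap.proj x ∘ₗ φ)
    fun h0 => hx (LinearMap.congr_fun h0 t)
  exact ⟨e.symm⟩

/-- Every simple module is a quotient, hence a submodule, of the semisimple module A / rad A, and is
determined by its isotypic component there. There are only finitely many such components. -/
instance finite_simpleClass (A : Type u) [Ring A] [IsArtinianRing A] : Finite (SimpleClass A) := by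
  let Q := A ⧸ Module.jacobson A A
  have hQ : IsSemisimpleModule A Q :=
    (IsArtinian.isSemisimpleModule_iff_jacobson A Q).2 (Module.jacobson_quotient_jacobson A A)
  have key : ∀ S : SimpleClass A, ∃ m : Submodule A Q, Nonempty (m ≃ₗ[A] S.out.1) := fun S => by
    have : IsSimpleModule A S.out.1 := S.out.2
    have : Nontrivial S.out.1 := IsSimpleModule.nontrivial A S.out.1
    obtain ⟨t, ht⟩ := exists_ne (0 : S.out.1)
    let f := LinearMap.toSpanSingleton A S.out.1 t
    have hf := IsSimpleModule.toSpanSingleton_surjective A ht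
    let g : Q →ₗ[A] S.out.1 := Submodule.liftQ _ f fun x hx => by
      have := Module.le_comap_jacobson f hx
      rwa [IsSemisimpleModule.jacobson_eq_bot] at this
    have hg : Function.Surjective g := fun y => by
      obtain ⟨r, rfl⟩ := hf y
      exact ⟨Submodule.Quotient.mk r, rfl⟩
    obtain ⟨l, hl⟩ := IsSemisimpleModule.lifting_property g hg LinearMap.id
    exact ⟨LinearMap.range l, ⟨(LinearEquiv.ofInjective l
      (Function.LeftInverse.injective (g := g) fun x => LinearMap.congr_fun hl x)).symm⟩⟩
  choose m e using key
  have hm : ∀ S, IsSimpleModule A (m S) := fun S => by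
    have : IsSimpleModule A S.out.1 := S.out.2
    exact IsSimpleModule.congr (e S).some
  refine Finite.of_injective (β := isotypicComponents A Q)
    (fun S => ⟨isotypicComponent A Q (m S), m S, hm S, rfl⟩) fun S T hST => ?_
  have h1 : isotypicComponent A Q (m S) = isotypicComponent A Q (m T) := congrArg Subtype.val hST
  have := hm S
  have := hm T
  obtain ⟨e'⟩ := isIsotypicOfType_submodule_iff.1 (IsIsotypicOfType.isotypicComponent A Q (m T))
    (m S) (h1 ▸ (m S).le_isotypicComponent)
  rw [← Quotient.out_eq S, ← Quotient.out_eq T]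
  exact Quotient.sound ⟨(e S).some.symm.trans (e'.trans (e T).some)⟩

end Simple

/-! ### Quotients, submodules and lengths of uniserial modules -/

section UniserialModules

variable {R : Type*} [Ring R]

/-- A uniserial module of length `m + 1` with top `S` and socle `T`. -/
def Interval {B : Type u} [Ring B] (m : ℕ) (S T : Type*) [AddCommGroup S] [Module B S]
    [AddCommGroup T] [Module B T] : Prop :=
  ∃ (U : ModuleCat.{u} B) (p : U →ₗ[B] S) (i : T →ₗ[B] U), IsUniserial B U ∧
    Module.length B U = m + 1 ∧ Function.Surjective p ∧ Function.Injective i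

variable {M N S T : Type*} [AddCommGroup M] [Module R M] [AddCommGroup N] [Module R N]
  [AddCommGroup S] [Module R S] [AddCommGroup T] [Module R T]

theorem IsUniserial.le_ker (hM : IsUniserial R M) [IsSimpleModule R S] {p : M →ₗ[R] S}
    (hp : Function.Surjective p) {K : Submodule R M} (hK : K ≠ ⊤) : K ≤ LinearMap.ker p := by
  have h := LinearMap.isCoatom_ker_of_surjective hp
  rcases hM K (LinearMap.ker p) with h1 | h1
  · exact h1
  · exact (h1.eq_of_not_lt fun h2 => hK (h.2 _ h2)).ge

theorem isAtom_range [IsSimpleModule R T] {i : T →ₗ[R] M} (hi : Function.Injective i) :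
    IsAtom (LinearMap.range i) := by
  rw [← isSimpleModule_iff_isAtom]
  exact IsSimpleModule.congr (LinearEquiv.ofInjective i hi).symm

theorem IsUniserial.range_le (hM : IsUniserial R M) [IsSimpleModule R T] {i : T →ₗ[R] M}
    (hi : Function.Injective i) {K : Submodule R M} (hK : K ≠ ⊥) : LinearMap.range i ≤ K := by
  have h := isAtom_range hi
  rcases hM (LinearMap.range i) K with h1 | h1
  · exact h1
  · exact ((h.le_iff.1 h1).resolve_left hK).ge

theorem bijective_of_surjective_of_length_eq (f : M →ₗ[R] N) (hf : Function.Surjective f)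
    (h : Module.length R M = Module.length R N) (hN : Module.length R N ≠ ⊤) :
    Function.Bijective f := by
  refine ⟨?_, hf⟩
  have h1 := Module.length_eq_add_of_exact (LinearMap.ker f).subtype f
    (Submodule.subtype_injective _) hf (LinearMap.exact_subtype_ker_map f)
  rw [h] at h1
  have h2 : Module.length R (LinearMap.ker f) = 0 := by
    have h3 : 0 + Module.length R N = Module.length R (LinearMap.ker f) + Module.length R N := by
      rw [zero_add]; exact h1
    exact ((ENat.add_left_injective_of_ne_top hN) h3).symm
  rw [Module.length_eq_zero_iff, Submodule.subsingleton_iff_eq_bot] at h2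
  exact LinearMap.ker_eq_bot.1 h2

theorem bijective_of_injective_of_length_eq (f : M →ₗ[R] N) (hf : Function.Injective f)
    (h : Module.length R M = Module.length R N) (hN : Module.length R N ≠ ⊤) :
    Function.Bijective f := by
  refine ⟨hf, ?_⟩
  have h1 := Module.length_eq_add_of_exact f (LinearMap.range f).mkQ hf
    (Submodule.mkQ_surjective _) (LinearMap.exact_map_mkQ_range f)
  rw [h] at h1
  have h2 : Module.length R (N ⧸ LinearMap.range f) = 0 := by
    have h3 : Module.length R N + 0 = Module.length R N +
      Module.length R (N ⧸ LinearMap.range f) := by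
      rw [add_zero]; exact h1
    exact ((ENat.add_right_injective_of_ne_top hN) h3).symm
  rw [Module.length_eq_zero_iff, Submodule.Quotient.subsingleton_iff] at h2
  exact LinearMap.range_eq_top.1 h2

theorem exists_comp_eq_of_ker_le (f : M →ₗ[R] N) (hf : Function.Surjective f) (g : M →ₗ[R] S)
    (h : LinearMap.ker f ≤ LinearMap.ker g) : ∃ l : N →ₗ[R] S, l ∘ₗ f = g := by
  refine ⟨(LinearMap.ker f).liftQ g h ∘ₗ (f.quotKerEquivOfSurjective hf).symm.toLinearMap, ?_⟩
  ext x
  have : (f.quotKerEquivOfSurjective hf).symm (f x) = Submodule.Quotient.mk x := by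
    rw [LinearEquiv.symm_apply_eq]; rfl
  simp [this]

theorem exists_comp_eq_of_range_le (f : M →ₗ[R] N) (hf : Function.Injective f) (g : S →ₗ[R] N)
    (h : LinearMap.range g ≤ LinearMap.range f) : ∃ l : S →ₗ[R] M, f ∘ₗ l = g := by
  refine ⟨(LinearEquiv.ofInjective f hf).symm.toLinearMap ∘ₗ
    g.codRestrict (LinearMap.range f) fun x => h ⟨x, rfl⟩, ?_⟩
  ext x
  exact congrArg Subtype.val ((LinearEquiv.ofInjective f hf).apply_symm_apply _)

/-- The two kernels are comparable, so one quotient maps onto the other, and equal finite lengths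
make this map bijective. -/
theorem IsUniserial.equiv_of_surjective (hM : IsUniserial R M) (f : M →ₗ[R] S)
    (g : M →ₗ[R] T) (hf : Function.Surjective f) (hg : Function.Surjective g)
    (h : Module.length R S = Module.length R T) (hT : Module.length R T ≠ ⊤) :
    Nonempty (S ≃ₗ[R] T) := by
  rcases hM (LinearMap.ker f) (LinearMap.ker g) with h1 | h1
  · obtain ⟨l, rfl⟩ := exists_comp_eq_of_ker_le f hf g h1
    exact ⟨LinearEquiv.ofBijective l (bijective_of_surjective_of_length_eq l
      (Function.Surjective.of_comp (g := f) hg) h hT)⟩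
  · obtain ⟨l, rfl⟩ := exists_comp_eq_of_ker_le g hg f h1
    exact ⟨(LinearEquiv.ofBijective l (bijective_of_surjective_of_length_eq l
      (Function.Surjective.of_comp (g := g) hf) h.symm (h ▸ hT))).symm⟩

theorem IsUniserial.equiv_of_injective (hM : IsUniserial R M) (f : S →ₗ[R] M)
    (g : T →ₗ[R] M) (hf : Function.Injective f) (hg : Function.Injective g)
    (h : Module.length R S = Module.length R T) (hT : Module.length R T ≠ ⊤) :
    Nonempty (S ≃ₗ[R] T) := by
  rcases hM (LinearMap.range f) (LinearMap.range g) with h1 | h1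
  · obtain ⟨l, rfl⟩ := exists_comp_eq_of_range_le g hg f h1
    exact ⟨LinearEquiv.ofBijective l (bijective_of_injective_of_length_eq l
      (Function.Injective.of_comp (f := g) hf) h hT)⟩
  · obtain ⟨l, rfl⟩ := exists_comp_eq_of_range_le f hf g h1
    exact ⟨(LinearEquiv.ofBijective l (bijective_of_injective_of_length_eq l
      (Function.Injective.of_comp (f := f) hg) h.symm (h ▸ hT))).symm⟩

theorem IsUniserial.jacobson_eq (hM : IsUniserial R M) [IsSimpleModule R S] {p : M →ₗ[R] S}
    (hp : Function.Surjective p) : Module.jacobson R M = LinearMap.ker p := by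
  have h := LinearMap.isCoatom_ker_of_surjective hp
  refine le_antisymm (sInf_le h) (le_sInf fun K hK => ?_)
  exact ((hK.le_iff.1 (hM.le_ker hp hK.1)).resolve_left h.1).le

theorem IsUniserial.soc_eq (hM : IsUniserial R M) [IsSimpleModule R T] {i : T →ₗ[R] M}
    (hi : Function.Injective i) : soc R M = LinearMap.range i := by
  have h := isAtom_range hi
  refine le_antisymm (sSup_le fun K hK => ?_) (le_sSup (isSimpleModule_iff_isAtom.2 h))
  have hK' := isSimpleModule_iff_isAtom.1 hK
  exact ((hK'.le_iff.1 (hM.range_le hi hK'.1)).resolve_left h.1).ge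

theorem IsUniserial.eq_top_of_notMem (hM : IsUniserial R M) [IsSimpleModule R S] {p : M →ₗ[R] S}
    (hp : Function.Surjective p) {K : Submodule R M} {x : M} (hx : x ∈ K) (hpx : p x ≠ 0) :
    K = ⊤ := by
  by_contra hK
  exact hpx (hM.le_ker hp hK hx)

/-- Any element outside the largest proper submodule generates M, so M is a quotient of R. -/
theorem IsUniserial.length_le [IsSimpleModule R S] (hM : IsUniserial R M) {p : M →ₗ[R] S}
    (hp : Function.Surjective p) : Module.length R M ≤ Module.length R R := by
  have : Nontrivial S := IsSimpleModule.nontrivial R S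
  obtain ⟨s, hs⟩ := exists_ne (0 : S)
  obtain ⟨x, rfl⟩ := hp s
  refine Module.length_le_of_surjective (LinearMap.toSpanSingleton R M x) ?_
  rw [← LinearMap.range_eq_top]
  exact hM.eq_top_of_notMem hp ⟨1, by simp⟩ hs

theorem length_simple_add (p : M →ₗ[R] S) (hp : Function.Surjective p) [IsSimpleModule R S] :
    Module.length R M = Module.length R (LinearMap.ker p) + 1 := by
  rw [Module.length_eq_add_of_exact (LinearMap.ker p).subtype p (Submodule.subtype_injective _) hp
    (LinearMap.exact_subtype_ker_map p), Module.length_eq_one R S]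

theorem length_quotient_add (i : T →ₗ[R] M) (hi : Function.Injective i) [IsSimpleModule R T] :
    Module.length R M = Module.length R (M ⧸ LinearMap.range i) + 1 := by
  rw [Module.length_eq_add_of_exact i (LinearMap.range i).mkQ hi
    (Submodule.mkQ_surjective _) (LinearMap.exact_map_mkQ_range i), Module.length_eq_one R T,
    add_comm]

end UniserialModules

/-! ### Covers and envelopes of simple modules -/

section Covers

variable {R : Type*} [Ring R] {P X I T : Type*} [AddCommGroup P] [Module R P] [AddCommGroup X]
  [Module R X] [AddCommGroup I] [Module R I] [AddCommGroup T] [Module R T]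

/-- The kernel is maximal because X is simple. A submodule not contained in it would span P together
with it, contradicting superfluity. So P is local. -/
theorem IsProjectiveCover.le_ker {p : P →ₗ[R] X} (hp : IsProjectiveCover p) [IsSimpleModule R X]
    {K : Submodule R P} (hK : K ≠ ⊤) : K ≤ LinearMap.ker p := by
  have h := LinearMap.isCoatom_ker_of_surjective hp.surjective
  by_contra hcon
  refine hK (hp.superfluous K (h.2 _ (lt_of_le_of_ne le_sup_right fun heq => hcon ?_)))
  rw [heq]
  exact le_sup_left

theorem IsProjectiveCover.finite {p : P →ₗ[R] X} (hp : IsProjectiveCover p) [IsSimpleModule R X] :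
    Module.Finite R P := by
  have : Nontrivial X := IsSimpleModule.nontrivial R X
  obtain ⟨s, hs⟩ := exists_ne (0 : X)
  obtain ⟨x, rfl⟩ := hp.surjective s
  refine Module.Finite.of_surjective (LinearMap.toSpanSingleton R P x) ?_
  rw [← LinearMap.range_eq_top]
  by_contra hcon
  exact hs (hp.le_ker hcon ⟨1, by simp⟩)

theorem IsProjectiveCover.isIndecomposable {p : P →ₗ[R] X} (hp : IsProjectiveCover p)
    [IsSimpleModule R X] : IsIndecomposable R P := by
  have h := LinearMap.isCoatom_ker_of_surjective hp.surjective
  have : Nontrivial X := IsSimpleModule.nontrivial R X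
  refine ⟨hp.surjective.nontrivial, fun K L hKL => ?_⟩
  by_cases hK : K = ⊤
  · right
    have := hKL.inf_eq_bot
    rwa [hK, top_inf_eq] at this
  · by_cases hL : L = ⊤
    · left
      have := hKL.inf_eq_bot
      rwa [hL, inf_top_eq] at this
    · exact absurd (eq_top_iff.2 (hKL.sup_eq_top ▸ sup_le (hp.le_ker hK) (hp.le_ker hL))) h.1

theorem IsInjectiveEnvelope.range_le {i : T →ₗ[R] I} (hi : IsInjectiveEnvelope i)
    [IsSimpleModule R T] {K : Submodule R I} (hK : K ≠ ⊥) : LinearMap.range i ≤ K := by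
  have h := isAtom_range hi.injective
  by_contra hcon
  refine hK (hi.essential K ((h.le_iff.1 inf_le_right).resolve_right fun heq => hcon ?_))
  rw [← heq]
  exact inf_le_left

end Covers

/-! ### Covers and envelopes over Nakayama rings are uniserial -/

section NakayamaRings

/-- An artinian ring whose finitely generated indecomposable modules are uniserial and which has
no simple projective module. -/
class NakayamaRing (B : Type u) [Ring B] : Prop where
  isArtinianRing : IsArtinianRing B
  uniserial : ∀ M : ModuleCat.{u} B, Module.Finite B M → IsIndecomposable B M → IsUniserial B M
  not_projective : ∀ M : ModuleCat.{u} B, IsSimpleModule B M → ¬ Module.Projective B M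

variable {B : Type u} [Ring B] [NakayamaRing B]

instance : IsArtinianRing B := NakayamaRing.isArtinianRing

theorem IsProjectiveCover.isUniserial {P : Type u} {X : Type*} [AddCommGroup P] [Module B P]
    [AddCommGroup X] [Module B X] [IsSimpleModule B X] {p : P →ₗ[B] X}
    (hp : IsProjectiveCover p) : IsUniserial B P :=
  NakayamaRing.uniserial (ModuleCat.of B P) hp.finite hp.isIndecomposable

/-- The envelope is not yet known to be finitely generated, so the Nakayama condition is applied to
a submodule generated by two elements that witness incomparability. It is indecomposable, since any
two nonzero submodules of I share the image of T. -/
theorem IsInjectiveEnvelope.isUniserial {I : Type u} {T : Type*} [AddCommGroup I] [Module B I]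
    [AddCommGroup T] [Module B T] [IsSimpleModule B T] {i : T →ₗ[B] I}
    (hi : IsInjectiveEnvelope i) : IsUniserial B I := by
  intro N N'
  by_contra! hcon
  obtain ⟨⟨x, hxN, hxN'⟩, ⟨y, hyN', hyN⟩⟩ :=
    And.intro (SetLike.not_le_iff_exists.1 hcon.1) (SetLike.not_le_iff_exists.1 hcon.2)
  let M := Submodule.span B {x, y}
  have hx : x ∈ M := Submodule.subset_span (by simp)
  have hy : y ∈ M := Submodule.subset_span (by simp)
  have hfin : Module.Finite B M := Module.Finite.span_of_finite B (by simp)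
  have hind : IsIndecomposable B M := by
    refine ⟨⟨⟨x, hx⟩, 0, fun h => hxN' ?_⟩, fun K L hKL => ?_⟩
    · have : x = 0 := congrArg Subtype.val h
      rw [this]; exact zero_mem _
    · by_contra! h
      have hK : K.map M.subtype ≠ ⊥ := fun h0 => h.1
        (Submodule.map_injective_of_injective M.subtype_injective (h0.trans
          (Submodule.map_bot _).symm))
      have hL : L.map M.subtype ≠ ⊥ := fun h0 => h.2
        (Submodule.map_injective_of_injective M.subtype_injective (h0.trans
          (Submodule.map_bot _).symm))
      have h1 := le_inf (hi.range_le hK) (hi.range_le hL)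
      rw [← Submodule.map_inf _ M.subtype_injective, hKL.inf_eq_bot, Submodule.map_bot] at h1
      exact (isAtom_range hi.injective).1 (eq_bot_iff.2 h1)
  rcases NakayamaRing.uniserial (ModuleCat.of B M) hfin hind (Submodule.span B {⟨x, hx⟩})
    (Submodule.span B {⟨y, hy⟩}) with h | h
  · rw [Submodule.span_singleton_le_iff_mem, Submodule.mem_span_singleton] at h
    obtain ⟨a, ha⟩ := h
    have : a • y = x := congrArg Subtype.val ha
    exact hxN' (this ▸ N'.smul_mem a hyN')
  · rw [Submodule.span_singleton_le_iff_mem, Submodule.mem_span_singleton] at h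
    obtain ⟨a, ha⟩ := h
    have : a • x = y := congrArg Subtype.val ha
    exact hyN (this ▸ N.smul_mem a hxN)

/-- Cyclic submodules have length at most that of B and form a chain, so one of maximal length is
everything. -/
theorem IsInjectiveEnvelope.finite {I : Type u} {T : Type*} [AddCommGroup I] [Module B I]
    [AddCommGroup T] [Module B T] [IsSimpleModule B T] {i : T →ₗ[B] I}
    (hi : IsInjectiveEnvelope i) : Module.Finite B I := by
  have hlen : ∀ x : I, Module.length B (Submodule.span B {x}) ≤ Module.length B B := fun x => by
    rw [← LinearMap.range_toSpanSingleton]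
    exact Module.length_le_of_surjective _ (LinearMap.toSpanSingleton B I x).surjective_rangeRestrict
  obtain ⟨ℓ, hℓ⟩ := ENat.ne_top_iff_exists.1 (Module.length_ne_top (R := B) (M := B))
  let s : Set ℕ := {n | ∃ x : I, Module.length B (Submodule.span B {x}) = n}
  have hne : s.Nonempty := by
    obtain ⟨n, hn⟩ := ENat.ne_top_iff_exists.1
      (Module.length_ne_top (R := B) (M := Submodule.span B {(0 : I)}))
    exact ⟨n, 0, hn.symm⟩
  have hbdd : BddAbove s := ⟨ℓ, by
    rintro n ⟨x, hx⟩
    have := hlen x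
    rw [hx, ← hℓ] at this
    exact_mod_cast this⟩
  obtain ⟨x, hx⟩ := Nat.sSup_mem hne hbdd
  refine ⟨⟨{x}, eq_top_iff.2 fun y _ => ?_⟩⟩
  rw [Finset.coe_singleton]
  rcases hi.isUniserial (Submodule.span B {x}) (Submodule.span B {y}) with h | h
  · have hxy : Submodule.span B {x} = Submodule.span B {y} := by
      obtain ⟨n, hn⟩ := ENat.ne_top_iff_exists.1
        (Module.length_ne_top (R := B) (M := Submodule.span B {y}))
      have hn' : n ≤ sSup s := le_csSup hbdd ⟨y, hn.symm⟩
      have hle := Module.length_le_of_injective _ (Submodule.inclusion_injective h)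
      have heq := le_antisymm hle (by rw [hx, ← hn]; exact_mod_cast hn')
      have := (bijective_of_injective_of_length_eq _ (Submodule.inclusion_injective h) heq
        Module.length_ne_top).2
      refine le_antisymm h fun z hz => ?_
      obtain ⟨w, hw⟩ := this ⟨z, hz⟩
      rw [← show (w : I) = z from congrArg Subtype.val hw]
      exact w.2
    rw [hxy]
    exact Submodule.mem_span_singleton_self y
  · exact h (Submodule.mem_span_singleton_self y)

end NakayamaRings

/-! ### Uniserial modules with prescribed length, top and socle -/

section Intervals

variable {B : Type u} [Ring B]

theorem exists_isInjectiveEnvelope_of_finite (T : Type*) [AddCommGroup T] [Module B T]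
    [Module.Finite B T] : ∃ (I : ModuleCat.{u} B) (i : T →ₗ[B] I), IsInjectiveEnvelope i := by
  have : Small.{u} T := Module.Finite.small B T
  let e := Shrink.linearEquiv.{u} B T
  obtain ⟨I, i, hi⟩ := exists_isInjectiveEnvelope (R := B) (Shrink.{u} T)
  refine ⟨I, i ∘ₗ e.symm.toLinearMap, ⟨hi.isInjective, hi.injective.comp e.symm.injective, ?_⟩⟩
  have : LinearMap.range (i ∘ₗ e.symm.toLinearMap) = LinearMap.range i := by
    rw [LinearMap.range_comp_of_range_eq_top _ e.symm.range]
  rw [this]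
  exact hi.essential

variable {S S' T T' : Type*} [AddCommGroup S] [Module B S] [AddCommGroup S'] [Module B S']
  [AddCommGroup T] [Module B T] [AddCommGroup T'] [Module B T']

theorem Interval.congr {m : ℕ} (h : Interval (B := B) m S T) (e : S ≃ₗ[B] S') (e' : T ≃ₗ[B] T') :
    Interval (B := B) m S' T' := by
  obtain ⟨U, p, i, hU, hl, hp, hi⟩ := h
  exact ⟨U, e.toLinearMap ∘ₗ p, i ∘ₗ e'.symm.toLinearMap, hU, hl, e.surjective.comp hp,
    hi.comp e'.symm.injective⟩

theorem interval_zero_iff [IsSimpleModule B S] [IsSimpleModule B T] :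
    Interval (B := B) 0 S T ↔ Nonempty (S ≃ₗ[B] T) := by
  constructor
  · rintro ⟨U, p, i, -, hl, hp, hi⟩
    have hU : IsSimpleModule B U := Module.length_eq_one_iff.1 (by simpa using hl)
    have : Nontrivial S := IsSimpleModule.nontrivial B S
    have : Nontrivial T := IsSimpleModule.nontrivial B T
    obtain ⟨e⟩ := equiv_of_ne_zero (f := p) fun h => by
      obtain ⟨s, hs⟩ := exists_ne (0 : S)
      obtain ⟨x, rfl⟩ := hp s
      exact hs (by rw [h]; rfl)
    obtain ⟨e'⟩ := equiv_of_ne_zero (f := i) fun h => by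
      obtain ⟨s, hs⟩ := exists_ne (0 : T)
      exact hs (hi (by rw [h]; rfl))
    exact ⟨e.symm.trans e'.symm⟩
  · rintro ⟨e⟩
    have : Small.{u} S := Module.Finite.small B S
    let f := Shrink.linearEquiv.{u} B S
    have hs : IsSimpleModule B (Shrink.{u} S) := IsSimpleModule.congr f
    refine ⟨ModuleCat.of B (Shrink.{u} S), f.toLinearMap, (e.symm.trans f.symm).toLinearMap,
      fun N N' => ?_, by simp [Module.length_eq_one], f.surjective,
      (e.symm.trans f.symm).injective⟩
    rcases eq_bot_or_eq_top N with h | h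
    · exact Or.inl (h ▸ bot_le)
    · exact Or.inr (h ▸ le_top)

/-- Factor out a maximal submodule of the radical `ker p`. The surjection `g` is kept because the
transpose computation needs Z as the top of that same radical. -/
theorem exists_interval_one {U : Type u} [AddCommGroup U] [Module B U] (hU : IsUniserial B U)
    [IsNoetherian B U] [IsSimpleModule B S] {p : U →ₗ[B] S} (hp : Function.Surjective p)
    (hker : LinearMap.ker p ≠ ⊥) : ∃ (Z : ModuleCat.{u} B) (g : LinearMap.ker p →ₗ[B] Z),
      IsSimpleModule B Z ∧ Function.Surjective g ∧ Interval (B := B) 1 S Z := by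
  let V := LinearMap.ker p
  have hV : Nontrivial V := Submodule.nontrivial_iff_ne_bot.2 hker
  obtain ⟨K, hK, -⟩ := (eq_top_or_exists_le_coatom (⊥ : Submodule B V)).resolve_left bot_ne_top
  have hZ : IsSimpleModule B (V ⧸ K) := isSimpleModule_iff_isCoatom.2 hK
  let L := K.map V.subtype
  have hL : L ≤ V := Submodule.map_subtype_le _ _
  let p' : (U ⧸ L) →ₗ[B] S := L.liftQ p hL
  let g' : (V ⧸ K) →ₗ[B] (U ⧸ L) := K.mapQ L V.subtype (Submodule.le_comap_map _ _)
  have hp' : Function.Surjective p' := fun s => by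
    obtain ⟨x, rfl⟩ := hp s
    exact ⟨Submodule.Quotient.mk x, rfl⟩
  have hg' : Function.Injective g' := by
    rw [← LinearMap.ker_eq_bot, Submodule.ker_mapQ,
      Submodule.comap_map_eq_of_injective V.subtype_injective, Submodule.mkQ_map_self]
  have hex : Function.Exact g' p' := by
    intro y
    obtain ⟨x, rfl⟩ := L.mkQ_surjective y
    constructor
    · intro h
      exact ⟨K.mkQ ⟨x, h⟩, rfl⟩
    · rintro ⟨z, hz⟩
      obtain ⟨w, rfl⟩ := K.mkQ_surjective z
      rw [← hz]
      exact w.2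
  refine ⟨ModuleCat.of B (V ⧸ K), K.mkQ, hZ, K.mkQ_surjective, ModuleCat.of B (U ⧸ L), p', g',
    hU.of_surjective L.mkQ L.mkQ_surjective, ?_, hp', hg'⟩
  have := Module.length_eq_add_of_exact g' p' hg' hp' hex
  rw [Module.length_eq_one B (V ⧸ K), Module.length_eq_one B S] at this
  exact_mod_cast this

/-- Passing to the radical removes the top; the new top is the second composition factor. -/
theorem Interval.exists_left [IsSimpleModule B S] [IsSimpleModule B T] {m : ℕ}
    (h : Interval (B := B) (m + 1) S T) : ∃ Z : ModuleCat.{u} B, IsSimpleModule B Z ∧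
      Interval (B := B) 1 S Z ∧ Interval (B := B) m Z T := by
  obtain ⟨U, p, i, hU, hl, hp, hi⟩ := h
  have hfin : IsFiniteLength B U := Module.length_ne_top_iff.1 (by rw [hl]; simp)
  obtain ⟨hn, -⟩ := isFiniteLength_iff_isNoetherian_isArtinian.1 hfin
  have hk := length_simple_add p hp
  rw [hl] at hk
  have hk' : Module.length B (LinearMap.ker p) = m + 1 := by
    have : Module.length B (LinearMap.ker p) + 1 = ((m + 1 : ℕ) : ℕ∞) + 1 := hk.symm
    have := ENat.add_left_injective_of_ne_top ENat.one_ne_top this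
    simpa using this
  have hker : LinearMap.ker p ≠ ⊥ := by
    intro h
    rw [h, Module.length_bot] at hk'
    exact absurd hk'.symm (by simp)
  obtain ⟨Z, g, hZ, hg, h1⟩ := exists_interval_one hU hp hker
  refine ⟨Z, hZ, h1, ModuleCat.of B (LinearMap.ker p), g,
    i.codRestrict (LinearMap.ker p) fun x => hU.range_le hi hker ⟨x, rfl⟩,
    hU.of_injective _ (Submodule.subtype_injective _), hk', hg, fun x y hxy => ?_⟩
  exact hi (congrArg Subtype.val hxy)

theorem Interval.exists_pred_left [IsSimpleModule B S] [IsSimpleModule B T] {m : ℕ}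
    (h : Interval (B := B) (m + 1) S T) : ∃ Z : ModuleCat.{u} B, IsSimpleModule B Z ∧
      Interval (B := B) m Z T :=
  let ⟨Z, h1, _, h2⟩ := h.exists_left
  ⟨Z, h1, h2⟩

theorem Interval.exists_pred_right [IsSimpleModule B S] [IsSimpleModule B T] {m : ℕ}
    (h : Interval (B := B) (m + 1) S T) : ∃ Z : ModuleCat.{u} B, IsSimpleModule B Z ∧
      Interval (B := B) m S Z := by
  obtain ⟨U, p, i, hU, hl, hp, hi⟩ := h
  have hk := length_quotient_add i hi
  rw [hl] at hk
  have hk' : Module.length B (U ⧸ LinearMap.range i) = m + 1 := by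
    have : Module.length B (U ⧸ LinearMap.range i) + 1 = ((m + 1 : ℕ) : ℕ∞) + 1 := hk.symm
    have := ENat.add_left_injective_of_ne_top ENat.one_ne_top this
    simpa using this
  have hfin : IsFiniteLength B (U ⧸ LinearMap.range i) :=
    Module.length_ne_top_iff.1 (by rw [hk']; simp)
  obtain ⟨-, ha⟩ := isFiniteLength_iff_isNoetherian_isArtinian.1 hfin
  have hnt : Nontrivial (U ⧸ LinearMap.range i) := Module.length_pos_iff.1 (by rw [hk']; simp)
  obtain ⟨K, hK, -⟩ :=
    (eq_bot_or_exists_atom_le (⊤ : Submodule B (U ⧸ LinearMap.range i))).resolve_left top_ne_bot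
  have hle : LinearMap.range i ≤ LinearMap.ker p := hU.range_le hi fun h0 => by
    have h2 := length_simple_add p hp
    rw [h0, Module.length_bot, hl] at h2
    have : m + 1 + 1 = 0 + 1 := by exact_mod_cast h2
    omega
  refine ⟨ModuleCat.of B K, isSimpleModule_iff_isAtom.2 hK,
    ModuleCat.of B (U ⧸ LinearMap.range i), (LinearMap.range i).liftQ p hle, K.subtype,
    hU.of_surjective _ (Submodule.mkQ_surjective _), hk', fun s => ?_, K.subtype_injective⟩
  obtain ⟨x, rfl⟩ := hp s
  exact ⟨Submodule.Quotient.mk x, rfl⟩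

/-- The lift of π hits an element outside the largest proper submodule of U. So all uniserial
modules with top S are quotients of P. -/
theorem IsProjectiveCover.exists_surjective [IsSimpleModule B S] {P : Type u} [AddCommGroup P]
    [Module B P] {π : P →ₗ[B] S} (hπ : IsProjectiveCover π) {U : Type u} [AddCommGroup U]
    [Module B U] (hU : IsUniserial B U) {p : U →ₗ[B] S} (hp : Function.Surjective p) :
    ∃ f : P →ₗ[B] U, Function.Surjective f ∧ p ∘ₗ f = π := by
  have := hπ.projective
  obtain ⟨f, hf⟩ := Module.projective_lifting_property p π hp
  refine ⟨f, ?_, hf⟩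
  have : Nontrivial S := IsSimpleModule.nontrivial B S
  obtain ⟨s, hs⟩ := exists_ne (0 : S)
  obtain ⟨x, rfl⟩ := hπ.surjective s
  rw [← LinearMap.range_eq_top]
  refine hU.eq_top_of_notMem hp ⟨x, rfl⟩ ?_
  rw [← hf] at hs
  exact hs

/-- A nonzero kernel would contain the socle of U, on which the extension is injective. -/
theorem IsInjectiveEnvelope.exists_injective [IsSimpleModule B T] {I : Type u} [AddCommGroup I]
    [Module B I] {j : T →ₗ[B] I} (hj : IsInjectiveEnvelope j) {U : Type u} [AddCommGroup U]
    [Module B U] (hU : IsUniserial B U) {i : T →ₗ[B] U} (hi : Function.Injective i) :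
    ∃ f : U →ₗ[B] I, Function.Injective f ∧ f ∘ₗ i = j := by
  have := hj.isInjective
  obtain ⟨f, hf⟩ := Module.Injective.extension_property B I _ _ i hi j
  refine ⟨f, ?_, hf⟩
  have : Nontrivial T := IsSimpleModule.nontrivial B T
  obtain ⟨t, ht⟩ := exists_ne (0 : T)
  rw [← LinearMap.ker_eq_bot]
  by_contra hcon
  have h1 : f (i t) = 0 := hU.range_le hi hcon ⟨t, rfl⟩
  have h2 : j t = 0 := by rw [← hf]; exact h1
  exact ht (hj.injective (h2.trans (map_zero j).symm))

variable [NakayamaRing B]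

/-- Both modules are quotients of the same uniserial projective cover and have equal length, so they
are isomorphic and share their socle. -/
theorem Interval.right_unique [IsSimpleModule B S] [IsSimpleModule B T] [IsSimpleModule B T']
    {m : ℕ} (h : Interval (B := B) m S T) (h' : Interval (B := B) m S T') :
    Nonempty (T ≃ₗ[B] T') := by
  obtain ⟨U, p, i, hU, hl, hp, hi⟩ := h
  obtain ⟨U', p', i', hU', hl', hp', hi'⟩ := h'
  obtain ⟨P, π, hπ⟩ := exists_isProjectiveCover (R := B) S
  obtain ⟨f, hf, -⟩ := hπ.exists_surjective hU hp
  obtain ⟨f', hf', -⟩ := hπ.exists_surjective hU' hp'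
  obtain ⟨e⟩ := hπ.isUniserial.equiv_of_surjective f f' hf hf' (hl.trans hl'.symm)
    (by rw [hl']; simp)
  exact hU'.equiv_of_injective (e.toLinearMap ∘ₗ i) i' (e.injective.comp hi) hi'
    (by simp [Module.length_eq_one]) (by simp [Module.length_eq_one])

theorem Interval.left_unique [IsSimpleModule B S] [IsSimpleModule B T] [IsSimpleModule B S']
    {m : ℕ} (h : Interval (B := B) m S T) (h' : Interval (B := B) m S' T) :
    Nonempty (S ≃ₗ[B] S') := by
  obtain ⟨U, p, i, hU, hl, hp, hi⟩ := h
  obtain ⟨U', p', i', hU', hl', hp', hi'⟩ := h'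
  obtain ⟨I, j, hj⟩ := exists_isInjectiveEnvelope_of_finite (B := B) T
  obtain ⟨f, hf, -⟩ := hj.exists_injective hU hi
  obtain ⟨f', hf', -⟩ := hj.exists_injective hU' hi'
  obtain ⟨e⟩ := hj.isUniserial.equiv_of_injective f f' hf hf' (hl.trans hl'.symm)
    (by rw [hl']; simp)
  exact hU.equiv_of_surjective p (p' ∘ₗ e.toLinearMap) hp (hp'.comp e.surjective)
    (by simp [Module.length_eq_one]) (by simp [Module.length_eq_one])

theorem not_projective_simple (S : Type*) [AddCommGroup S] [Module B S] [IsSimpleModule B S] :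
    ¬ Module.Projective B S := fun h => by
  have : Small.{u} S := Module.Finite.small B S
  let f := Shrink.linearEquiv.{u} B S
  exact NakayamaRing.not_projective (ModuleCat.of B (Shrink.{u} S)) (IsSimpleModule.congr f)
    (Module.Projective.of_equiv f.symm)

theorem IsProjectiveCover.ker_ne_bot [IsSimpleModule B S] {P : Type*} [AddCommGroup P] [Module B P]
    {π : P →ₗ[B] S} (hπ : IsProjectiveCover π) : LinearMap.ker π ≠ ⊥ := fun h => by
  have := hπ.projective
  exact not_projective_simple (B := B) S (Module.Projective.of_equiv
    (LinearEquiv.ofBijective π ⟨LinearMap.ker_eq_bot.1 h, hπ.surjective⟩))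

/-- As no simple module is projective, the projective cover of S has a nonzero radical. -/
theorem exists_interval_one_right (S : Type*) [AddCommGroup S] [Module B S] [IsSimpleModule B S] :
    ∃ Z : ModuleCat.{u} B, IsSimpleModule B Z ∧ Interval (B := B) 1 S Z := by
  obtain ⟨P, π, hπ⟩ := exists_isProjectiveCover (R := B) S
  have := hπ.finite
  obtain ⟨Z, -, hZ, -, h⟩ := exists_interval_one hπ.isUniserial hπ.surjective hπ.ker_ne_bot
  exact ⟨Z, hZ, h⟩

end Intervals

/-! ### The permutation τ and the length functions p and q -/

section Translation

variable (B : Type u) [Ring B]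

instance (S : SimpleClass B) : IsSimpleModule B S.out.1 := S.out.2

variable {B}

theorem SimpleMod.cls_eq_iff {M N : SimpleMod B} : M.cls = N.cls ↔ Nonempty (M.1 ≃ₗ[B] N.1) :=
  Quotient.eq

theorem SimpleMod.cls_out (S : SimpleClass B) : SimpleMod.cls S.out = S := Quotient.out_eq S

/-- The isomorphism class of a simple module in the universe of the ring. -/
def clsOf (M : ModuleCat.{u} B) (hM : IsSimpleModule B M) : SimpleClass B := SimpleMod.cls ⟨M, hM⟩

theorem out_clsOf (M : ModuleCat.{u} B) (hM : IsSimpleModule B M) :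
    Nonempty ((clsOf M hM).out.1 ≃ₗ[B] M) :=
  SimpleMod.cls_eq_iff.1 (SimpleMod.cls_out (clsOf M hM))

theorem eq_of_equiv {S T : SimpleClass B} (e : S.out.1 ≃ₗ[B] T.out.1) : S = T := by
  rw [← SimpleMod.cls_out S, ← SimpleMod.cls_out T]
  exact SimpleMod.cls_eq_iff.2 ⟨e⟩

/-- `Interval` for isomorphism classes of simple modules. -/
def ClassInterval (m : ℕ) (S T : SimpleClass B) : Prop := Interval (B := B) m S.out.1 T.out.1

theorem classInterval_cls {m : ℕ} {M N : SimpleMod B} :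
    ClassInterval m M.cls N.cls ↔ Interval (B := B) m M.1 N.1 := by
  obtain ⟨e⟩ := SimpleMod.cls_eq_iff.1 (SimpleMod.cls_out M.cls)
  obtain ⟨e'⟩ := SimpleMod.cls_eq_iff.1 (SimpleMod.cls_out N.cls)
  exact ⟨fun h => h.congr e e', fun h => h.congr e.symm e'.symm⟩

theorem exists_classInterval_right_iff {m : ℕ} {S : SimpleClass B} :
    (∃ T, ClassInterval m S T) ↔ ∃ Z : ModuleCat.{u} B, IsSimpleModule B Z ∧
      Interval (B := B) m S.out.1 Z := by
  constructor
  · rintro ⟨T, hT⟩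
    exact ⟨T.out.1, T.out.2, hT⟩
  · rintro ⟨Z, hZ, h⟩
    obtain ⟨e⟩ := out_clsOf Z hZ
    exact ⟨clsOf Z hZ, h.congr (LinearEquiv.refl _ _) e.symm⟩

theorem exists_classInterval_left_iff {m : ℕ} {T : SimpleClass B} :
    (∃ S, ClassInterval m S T) ↔ ∃ Z : ModuleCat.{u} B, IsSimpleModule B Z ∧
      Interval (B := B) m Z T.out.1 := by
  constructor
  · rintro ⟨S, hS⟩
    exact ⟨S.out.1, S.out.2, hS⟩
  · rintro ⟨Z, hZ, h⟩
    obtain ⟨e⟩ := out_clsOf Z hZ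
    exact ⟨clsOf Z hZ, h.congr e.symm (LinearEquiv.refl _ _)⟩

theorem classInterval_zero {S T : SimpleClass B} : ClassInterval 0 S T ↔ S = T := by
  refine interval_zero_iff.trans ⟨fun ⟨e⟩ => eq_of_equiv e, ?_⟩
  rintro rfl
  exact ⟨LinearEquiv.refl _ _⟩

/-- The length of the projective cover of a simple module. -/
noncomputable def projLen (S : SimpleClass B) : ℕ := sInf {m | ¬ ∃ T, ClassInterval m S T}

/-- The length of the injective envelope of a simple module. -/
noncomputable def injLen (T : SimpleClass B) : ℕ := sInf {m | ¬ ∃ S, ClassInterval m S T}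

theorem lt_sInf_iff_of_antitone {Q : ℕ → Prop} (hQ : ∀ m, Q (m + 1) → Q m)
    (hne : ∃ m, ¬ Q m) (m : ℕ) : m < sInf {m | ¬ Q m} ↔ Q m := by
  have hanti : Antitone Q := antitone_nat_of_succ_le hQ
  constructor
  · intro h
    by_contra hm
    exact absurd (Nat.sInf_le (show m ∈ {m | ¬ Q m} from hm)) (not_le.2 h)
  · intro h
    by_contra hcon
    exact (Nat.sInf_mem (s := {m | ¬ Q m}) hne) (hanti (not_lt.1 hcon) h)

section

variable [IsArtinianRing B]

/-- Lengths of uniserial modules with simple top are bounded by that of B. This keeps the infima in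
`projLen` and `injLen` from being the default value on the empty set. -/
theorem exists_not_interval : ∃ m : ℕ, ∀ S T : SimpleClass B, ¬ ClassInterval m S T := by
  obtain ⟨ℓ, hℓ⟩ := ENat.ne_top_iff_exists.1 (Module.length_ne_top (R := B) (M := B))
  refine ⟨ℓ, fun S T h => ?_⟩
  obtain ⟨U, p, i, hU, hl, hp, hi⟩ := h
  have := hU.length_le hp
  rw [hl, ← hℓ] at this
  have : ℓ + 1 ≤ ℓ := by exact_mod_cast this
  omega

theorem lt_projLen_iff {S : SimpleClass B} {m : ℕ} :
    m < projLen S ↔ ∃ T, ClassInterval m S T := by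
  refine lt_sInf_iff_of_antitone (fun m h => ?_) ?_ m
  · obtain ⟨T, hT⟩ := h
    exact exists_classInterval_right_iff.2 hT.exists_pred_right
  · obtain ⟨m, hm⟩ := exists_not_interval (B := B)
    exact ⟨m, fun ⟨T, hT⟩ => hm S T hT⟩

theorem lt_injLen_iff {T : SimpleClass B} {m : ℕ} :
    m < injLen T ↔ ∃ S, ClassInterval m S T := by
  refine lt_sInf_iff_of_antitone (fun m h => ?_) ?_ m
  · obtain ⟨S, hS⟩ := h
    exact exists_classInterval_left_iff.2 hS.exists_pred_left
  · obtain ⟨m, hm⟩ := exists_not_interval (B := B)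
    exact ⟨m, fun ⟨S, hS⟩ => hm S T hS⟩

theorem projLen_pos (S : SimpleClass B) : 0 < projLen S :=
  lt_projLen_iff.2 ⟨S, classInterval_zero.2 rfl⟩

theorem injLen_pos (S : SimpleClass B) : 0 < injLen S :=
  lt_injLen_iff.2 ⟨S, classInterval_zero.2 rfl⟩

end

variable [NakayamaRing B]

theorem ClassInterval.right_unique {m : ℕ} {S T T' : SimpleClass B} (h : ClassInterval m S T)
    (h' : ClassInterval m S T') : T = T' :=
  eq_of_equiv (Interval.right_unique h h').some

theorem ClassInterval.left_unique {m : ℕ} {S S' T : SimpleClass B} (h : ClassInterval m S T)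
    (h' : ClassInterval m S' T) : S = S' :=
  eq_of_equiv (Interval.left_unique h h').some

theorem exists_classInterval_one (S : SimpleClass B) : ∃ T, ClassInterval 1 S T :=
  exists_classInterval_right_iff.2 (exists_interval_one_right S.out.1)

variable (B)

/-- The permutation of the simple modules that maps `S` to the top of the radical of the projective
cover of `S`. -/
noncomputable def translation : Equiv.Perm (SimpleClass B) :=
  Equiv.ofBijective (fun S => (exists_classInterval_one S).choose)
    (Finite.injective_iff_bijective.1 fun S T h =>
      (exists_classInterval_one S).choose_spec.left_unique
        (by rw [show (exists_classInterval_one S).choose = (exists_classInterval_one T).choose from h]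
            exact (exists_classInterval_one T).choose_spec))

variable {B}

theorem classInterval_translation (S : SimpleClass B) : ClassInterval 1 S (translation B S) :=
  (exists_classInterval_one S).choose_spec

theorem classInterval_one_iff {S T : SimpleClass B} :
    ClassInterval 1 S T ↔ T = translation B S :=
  ⟨fun h => h.right_unique (classInterval_translation S), fun h => h ▸ classInterval_translation S⟩

theorem ClassInterval.eq_pow {m : ℕ} {S T : SimpleClass B} (h : ClassInterval m S T) :
    T = (translation B ^ m) S := by
  induction m generalizing S with
  | zero => exact (classInterval_zero.1 h).symm
  | succ m ih =>
    obtain ⟨Z, hZ, h1, h2⟩ := Interval.exists_left h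
    obtain ⟨e⟩ := out_clsOf Z hZ
    have h3 : ClassInterval 1 S (clsOf Z hZ) := h1.congr (LinearEquiv.refl _ _) e.symm
    have h4 : ClassInterval m (clsOf Z hZ) T := h2.congr e.symm (LinearEquiv.refl _ _)
    rw [ih h4, classInterval_one_iff.1 h3, pow_succ, Equiv.Perm.mul_apply]

/-- Both sides express the existence of a uniserial module of length m + 1 from S down to τ^m S, as
the end is determined by the start and conversely. -/
theorem lt_projLen_iff_lt_injLen (S : SimpleClass B) (m : ℕ) :
    m < projLen S ↔ m < injLen ((translation B ^ m) S) := by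
  rw [lt_projLen_iff, lt_injLen_iff]
  constructor
  · rintro ⟨T, h⟩
    exact ⟨S, h.eq_pow ▸ h⟩
  · rintro ⟨S', h⟩
    obtain rfl := (translation B ^ m).injective h.eq_pow
    exact ⟨_, h⟩

/-- By surjectivity of τ there is a uniserial module of length two with socle T. A retraction onto T
would be injective, since it is so on the socle, and this contradicts the lengths. -/
theorem not_injective_simple {T : Type u} [AddCommGroup T] [Module B T] [hT : IsSimpleModule B T] :
    ¬ Module.Injective B T := fun hinj => by
  obtain ⟨e⟩ := out_clsOf (ModuleCat.of B T) hT
  obtain ⟨S, hS⟩ := (translation B).surjective (clsOf (ModuleCat.of B T) hT)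
  obtain ⟨U, p, i, hU, hl, hp, hi⟩ := hS ▸ classInterval_translation S
  obtain ⟨r, hr⟩ := Module.Injective.extension_property B T _ _ (i ∘ₗ e.symm.toLinearMap)
    (hi.comp e.symm.injective) LinearMap.id
  have hr' : ∀ t, r (i (e.symm t)) = t := fun t => LinearMap.congr_fun hr t
  have : Nontrivial T := IsSimpleModule.nontrivial B T
  have hker : LinearMap.ker r = ⊥ := by
    by_contra h
    obtain ⟨t, ht⟩ := exists_ne (0 : T)
    exact ht ((hr' t).symm.trans (hU.range_le hi h ⟨e.symm t, rfl⟩))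
  have := Module.length_le_of_injective r (LinearMap.ker_eq_bot.1 hker)
  rw [hl, Module.length_eq_one] at this
  exact absurd this (by decide)

end Translation

/-! ### The socle of PS and the top of IS as powers of τ -/

section SocleTop

variable {B : Type u} [Ring B] [NakayamaRing B]

/-- P is the longest uniserial module with top M, so its length is `projLen` and its socle lies one
step fewer below the top. -/
theorem IsProjectiveCover.exists_cls_soc_eq {M : SimpleMod B} {P : ModuleCat.{u} B}
    {p : P →ₗ[B] M.1} (hp : IsProjectiveCover p) :
    ∃ h : IsSimpleModule B (soc B P), clsOf (ModuleCat.of B (soc B P)) h =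
      (translation B ^ (projLen M.cls - 1)) M.cls := by
  have hM : IsSimpleModule B M.1 := M.2
  have hP := hp.isUniserial
  have hfin := hp.finite
  have hnt : Nontrivial P := hp.isIndecomposable.1
  obtain ⟨K, hK, -⟩ := (eq_bot_or_exists_atom_le (⊤ : Submodule B P)).resolve_left top_ne_bot
  have hKs : IsSimpleModule B K := isSimpleModule_iff_isAtom.2 hK
  have hsoc : soc B P = K := by
    rw [hP.soc_eq K.subtype_injective, Submodule.range_subtype]
  have hs : IsSimpleModule B (soc B P) := hsoc ▸ hKs
  refine ⟨hs, ?_⟩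
  obtain ⟨ℓ, hℓ⟩ := ENat.ne_top_iff_exists.1 (Module.length_ne_top (R := B) (M := P))
  have hpos := Module.length_pos (R := B) (M := P)
  rw [← hℓ] at hpos
  obtain ⟨n, rfl⟩ : ∃ n, ℓ = n + 1 := ⟨ℓ - 1, by have : 0 < ℓ := by exact_mod_cast hpos
                                                 omega⟩
  have hint : ClassInterval n M.cls (clsOf (ModuleCat.of B (soc B P)) hs) :=
    classInterval_cls.2 ⟨P, p, (soc B P).subtype, hP, by rw [← hℓ]; simp, hp.surjective,
      Submodule.subtype_injective _⟩
  have hn : projLen M.cls = n + 1 := by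
    refine le_antisymm (not_lt.1 fun h => ?_) (lt_projLen_iff.2 ⟨_, hint⟩)
    obtain ⟨T, hT⟩ := lt_projLen_iff.1 h
    rw [← SimpleMod.cls_out T] at hT
    obtain ⟨U, p', i, hU, hl, hp', hi⟩ := classInterval_cls.1 hT
    obtain ⟨f, hf, -⟩ := hp.exists_surjective hU hp'
    have := Module.length_le_of_surjective f hf
    rw [hl, ← hℓ] at this
    have : n + 1 + 1 ≤ n + 1 := by exact_mod_cast this
    omega
  rw [hn, Nat.add_sub_cancel]
  exact hint.eq_pow

theorem IsInjectiveEnvelope.exists_cls_top_eq {M : SimpleMod B} {I : ModuleCat.{u} B}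
    {i : M.1 →ₗ[B] I} (hi : IsInjectiveEnvelope i) :
    ∃ h : IsSimpleModule B (Top B I),
      (translation B ^ (injLen M.cls - 1)) (clsOf (ModuleCat.of B (Top B I)) h) = M.cls := by
  have hM : IsSimpleModule B M.1 := M.2
  have hI := hi.isUniserial
  have hfin := hi.finite
  have : Nontrivial M.1 := IsSimpleModule.nontrivial B M.1
  have hnt : Nontrivial I := hi.injective.nontrivial
  obtain ⟨K, hK, -⟩ := (eq_top_or_exists_le_coatom (⊥ : Submodule B I)).resolve_left bot_ne_top
  have hKs : IsSimpleModule B (I ⧸ K) := isSimpleModule_iff_isCoatom.2 hK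
  have hjac : Module.jacobson B I = K := by
    rw [hI.jacobson_eq K.mkQ_surjective, Submodule.ker_mkQ]
  have hs : IsSimpleModule B (Top B I) := isSimpleModule_iff_isCoatom.2 (hjac ▸ hK)
  refine ⟨hs, ?_⟩
  obtain ⟨ℓ, hℓ⟩ := ENat.ne_top_iff_exists.1 (Module.length_ne_top (R := B) (M := I))
  have hpos := Module.length_pos (R := B) (M := I)
  rw [← hℓ] at hpos
  obtain ⟨n, rfl⟩ : ∃ n, ℓ = n + 1 := ⟨ℓ - 1, by have : 0 < ℓ := by exact_mod_cast hpos
                                                 omega⟩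
  have hint : ClassInterval n (clsOf (ModuleCat.of B (Top B I)) hs) M.cls :=
    classInterval_cls.2 ⟨I, (Module.jacobson B I).mkQ, i, hI, by rw [← hℓ]; simp,
      Submodule.mkQ_surjective _, hi.injective⟩
  have hn : injLen M.cls = n + 1 := by
    refine le_antisymm (not_lt.1 fun h => ?_) (lt_injLen_iff.2 ⟨_, hint⟩)
    obtain ⟨T, hT⟩ := lt_injLen_iff.1 h
    rw [← SimpleMod.cls_out T] at hT
    obtain ⟨U, p', i', hU, hl, hp', hi'⟩ := classInterval_cls.1 hT
    obtain ⟨f, hf, -⟩ := hi.exists_injective hU hi'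
    have := Module.length_le_of_injective f hf
    rw [hl, ← hℓ] at this
    have : n + 1 + 1 ≤ n + 1 := by exact_mod_cast this
    omega
  rw [hn, Nat.add_sub_cancel]
  exact hint.eq_pow.symm

end SocleTop

/-! ### The transpose of a simple module -/

section Transpose

variable {B : Type u} [Ring B]

/-- A projective cover of a uniserial module is a projective cover of its top. -/
theorem IsProjectiveCover.comp_simple {V Y P₁ : Type*} [AddCommGroup V] [Module B V]
    [AddCommGroup Y] [Module B Y] [AddCommGroup P₁] [Module B P₁] [IsSimpleModule B Y]
    (hV : IsUniserial B V) {q : P₁ →ₗ[B] V} (hq : IsProjectiveCover q) {g : V →ₗ[B] Y}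
    (hg : Function.Surjective g) : IsProjectiveCover (g ∘ₗ q) := by
  have hgq : Function.Surjective (g ∘ₗ q) := by
    rw [LinearMap.coe_comp]
    exact hg.comp hq.surjective
  refine ⟨hq.projective, hgq, fun N hN => hq.superfluous N ?_⟩
  rw [← Submodule.comap_map_eq]
  have : N.map q = ⊤ := by
    by_contra h
    have h1 : N ≤ LinearMap.ker (g ∘ₗ q) := fun x hx => hV.le_ker hg h ⟨x, hx, rfl⟩
    rw [sup_eq_right.2 h1] at hN
    exact (LinearMap.isCoatom_ker_of_surjective hgq).1 hN
  rw [this, Submodule.comap_top]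

variable {P₁ Y : Type u} [AddCommGroup P₁] [Module B P₁] [AddCommGroup Y] [Module B Y]
  [IsSimpleModule B Y]

/-- The submodule W = f(rad P₁) is the radical of the image of f, so V / W has length two with Y at
the bottom. -/
theorem interval_one_of_covBy {Q : Type u} [AddCommGroup Q] [Module B Q] (hQ : IsUniserial B Q)
    (hP : IsUniserial B P₁) {y : P₁ →ₗ[B] Y} (hy : Function.Surjective y) {f : P₁ →ₗ[B] Q}
    (hf : f ≠ 0) {V : Submodule B Q} (hV : LinearMap.range f ⋖ V) :
    Interval (B := B) 1 (V ⧸ (LinearMap.range f).submoduleOf V) Y := by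
  have hs : IsSimpleModule B (V ⧸ (LinearMap.range f).submoduleOf V) :=
    (covBy_iff_quot_is_simple hV.le).1 hV
  let W : Submodule B V := ((LinearMap.ker y).map f).submoduleOf V
  let fV : P₁ →ₗ[B] V := f.codRestrict V fun x => hV.le ⟨x, rfl⟩
  have hker : LinearMap.ker y ≤ LinearMap.ker (W.mkQ ∘ₗ fV) := fun x hx => by
    rw [LinearMap.mem_ker, LinearMap.comp_apply, Submodule.mkQ_apply, Submodule.Quotient.mk_eq_zero]
    exact ⟨x, hx, rfl⟩
  obtain ⟨i, hi⟩ := exists_comp_eq_of_ker_le y hy _ hker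
  have hi' : ∀ x, i (y x) = W.mkQ (fV x) := fun x => LinearMap.congr_fun hi x
  -- If i vanished, f(P₁) = f(rad P₁) would make P₁ the sum of `ker f` and `ker y`; but f ≠ 0 puts
  -- `ker f` inside the proper submodule `ker y`.
  have hi0 : i ≠ 0 := fun h0 => by
    have hkf : LinearMap.ker f ≤ LinearMap.ker y :=
      hP.le_ker hy fun h => hf (LinearMap.ker_eq_top.1 h)
    have htop : LinearMap.ker y = ⊤ := eq_top_iff.2 fun x _ => by
      have h1 := hi' x
      rw [h0, LinearMap.zero_apply, eq_comm, Submodule.mkQ_apply,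
        Submodule.Quotient.mk_eq_zero] at h1
      obtain ⟨z, hz, hzx⟩ := h1
      have h2 : x - z ∈ LinearMap.ker f := by
        rw [LinearMap.mem_ker, map_sub, hzx]; exact sub_self _
      simpa using add_mem (hkf h2) hz
    exact (LinearMap.isCoatom_ker_of_surjective hy).1 htop
  have hinj := LinearMap.injective_of_ne_zero hi0
  have hle : W ≤ (LinearMap.range f).submoduleOf V := fun x hx => by
    obtain ⟨z, -, hz⟩ := hx
    exact ⟨z, hz⟩
  let p' : (V ⧸ W) →ₗ[B] (V ⧸ (LinearMap.range f).submoduleOf V) := Submodule.factor hle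
  have hp' : Function.Surjective p' := Submodule.factor_surjective hle
  have hex : Function.Exact i p' := fun z => by
    obtain ⟨v, rfl⟩ := W.mkQ_surjective z
    constructor
    · intro h
      have h' : v ∈ (LinearMap.range f).submoduleOf V := (Submodule.Quotient.mk_eq_zero _).1 h
      obtain ⟨x, hx⟩ := h'
      exact ⟨y x, (hi' x).trans (congrArg W.mkQ (Subtype.ext hx))⟩
    · rintro ⟨t, ht⟩
      obtain ⟨x, rfl⟩ := hy t
      rw [← ht, hi' x]
      exact (Submodule.Quotient.mk_eq_zero _).2 ⟨x, rfl⟩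
  refine ⟨ModuleCat.of B (V ⧸ W), p', i,
    (hQ.of_injective _ V.subtype_injective).of_surjective _ W.mkQ_surjective, ?_, hp', hinj⟩
  have := Module.length_eq_add_of_exact i p' hinj hp' hex
  rw [Module.length_eq_one B Y,
    Module.length_eq_one B (V ⧸ (LinearMap.range f).submoduleOf V)] at this
  exact_mod_cast this

theorem mem_range_lcomp_iff {C W : Type*} [AddCommGroup W] [Module B W] [Ring C] [Module C W]
    [SMulCommClass B C W] {M N : Type*} [AddCommGroup M] [Module B M] [AddCommGroup N] [Module B N]
    (d : M →ₗ[B] N) (f : M →ₗ[B] W) :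
    f ∈ LinearMap.range (LinearMap.lcomp C W d) ↔ ∃ h : N →ₗ[B] W, h ∘ₗ d = f :=
  Iff.rfl

variable [NakayamaRing B] {X : Type*} [AddCommGroup X] [Module B X] [IsSimpleModule B X]
  {P₀ : Type u} [AddCommGroup P₀] [Module B P₀] {p : P₀ →ₗ[B] X} {q : P₁ →ₗ[B] LinearMap.ker p}
  {g : LinearMap.ker p →ₗ[B] Y}

/-- The submodule V just above the image of f has top X, the only simple module that can sit over Y.
This makes the image short enough for f to descend to `ker p`; the extension to P₀ is then made in
an injective envelope and lands back in Q. -/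
theorem exists_extension_of_isUniserial (hp : IsProjectiveCover p) (hq : IsProjectiveCover q)
    (hg : Function.Surjective g) (hXY : Interval (B := B) 1 X Y) {Q : Type u} [AddCommGroup Q]
    [Module B Q] [Module.Finite B Q] (hQ : IsUniserial B Q) (f : P₁ →ₗ[B] Q)
    (hf : LinearMap.range f ≠ ⊤) :
    ∃ h : P₀ →ₗ[B] Q, h ∘ₗ (LinearMap.ker p).subtype ∘ₗ q = f := by
  by_cases hf0 : f = 0
  · exact ⟨0, by rw [hf0, LinearMap.zero_comp]⟩
  have hP0 := hp.isUniserial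
  have hfin0 := hp.finite
  have hV := hP0.of_injective _ (LinearMap.ker p).subtype_injective
  have hy := hq.comp_simple hV hg
  have hP1 := hy.isUniserial
  have hfin1 := hy.finite
  obtain ⟨V, hUV⟩ := exists_covBy_of_wellFoundedLT (a := LinearMap.range f) (by simpa using hf)
  have hs : IsSimpleModule B (V ⧸ (LinearMap.range f).submoduleOf V) :=
    (covBy_iff_quot_is_simple hUV.le).1 hUV
  obtain ⟨e⟩ := hXY.left_unique (interval_one_of_covBy hQ hP1 hy.surjective hf0 hUV)
  obtain ⟨h0, hh0, hph0⟩ := hp.exists_surjective (hQ.of_injective _ V.subtype_injective)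
    (p := e.symm.toLinearMap ∘ₗ ((LinearMap.range f).submoduleOf V).mkQ)
    (e.symm.surjective.comp (Submodule.mkQ_surjective _))
  -- P₀ maps onto V, and the preimage of the image of f lies in `ker p`.
  have hlen : Module.length B (LinearMap.range f) ≤ Module.length B (LinearMap.ker p) := by
    have h1 : LinearMap.range f ≤ LinearMap.range (V.subtype ∘ₗ h0 ∘ₗ (LinearMap.ker p).subtype) :=
      fun x hx => by
        obtain ⟨z, hz⟩ := hh0 ⟨x, hUV.le hx⟩
        refine ⟨⟨z, ?_⟩, congrArg Subtype.val hz⟩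
        rw [LinearMap.mem_ker, ← hph0, LinearMap.comp_apply, hz]
        refine (congrArg e.symm ?_).trans e.symm.map_zero
        exact (Submodule.Quotient.mk_eq_zero _).2 hx
    exact (Module.length_le_of_injective _ (Submodule.inclusion_injective h1)).trans
      (Module.length_le_of_surjective _ (LinearMap.surjective_rangeRestrict _))
  have hker : LinearMap.ker q ≤ LinearMap.ker f := by
    rcases hP1 (LinearMap.ker q) (LinearMap.ker f) with h | h
    · exact h
    · obtain ⟨l, hl⟩ := exists_comp_eq_of_ker_le f.rangeRestrict f.surjective_rangeRestrict q
        (by rwa [LinearMap.ker_rangeRestrict])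
      have hls : Function.Surjective l :=
        Function.Surjective.of_comp (g := f.rangeRestrict) (by
          rw [← LinearMap.coe_comp, hl]; exact hq.surjective)
      have hlb := bijective_of_surjective_of_length_eq l hls
        (le_antisymm hlen (Module.length_le_of_surjective l hls)) Module.length_ne_top
      intro x hx
      have h1 : l (f.rangeRestrict x) = 0 := (LinearMap.congr_fun hl x).trans hx
      have h2 := hlb.1 (h1.trans (map_zero l).symm)
      exact congrArg Subtype.val h2
  obtain ⟨f', hf'⟩ := exists_comp_eq_of_ker_le q hq.surjective f hker
  have hf'range : ∀ z, f' z ∈ LinearMap.range f := fun z => by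
    obtain ⟨x, rfl⟩ := hq.surjective z
    exact ⟨x, (LinearMap.congr_fun hf' x).symm⟩
  have hQnt : Nontrivial Q := by
    by_contra h
    rw [not_nontrivial_iff_subsingleton] at h
    exact hf0 (LinearMap.ext fun x => Subsingleton.elim _ _)
  obtain ⟨Z, hZ, -⟩ := (eq_bot_or_exists_atom_le (⊤ : Submodule B Q)).resolve_left top_ne_bot
  have hZs : IsSimpleModule B Z := isSimpleModule_iff_isAtom.2 hZ
  obtain ⟨I, j, hj⟩ := exists_isInjectiveEnvelope (R := B) Z
  obtain ⟨φ, hφ, -⟩ := hj.exists_injective hQ Z.subtype_injective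
  have := hj.isInjective
  obtain ⟨F, hF⟩ := Module.Injective.extension_property B I _ _ (LinearMap.ker p).subtype
    (Submodule.subtype_injective _) (φ ∘ₗ f')
  have hF' : ∀ z : LinearMap.ker p, F z = φ (f' z) := fun z => LinearMap.congr_fun hF z
  -- Otherwise φ(V) lies in the image of F and its preimage is a proper submodule, hence inside `ker
  -- p`. There F agrees with φ ∘ f', so V would be contained in the image of f.
  have hrange : LinearMap.range F ≤ V.map φ := by
    rcases hj.isUniserial (LinearMap.range F) (V.map φ) with h | h
    · exact h
    · by_cases htop : (V.map φ).comap F = ⊤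
      · rintro _ ⟨x, rfl⟩
        have : x ∈ (V.map φ).comap F := by rw [htop]; trivial
        exact this
      · refine absurd (fun v hv => ?_ : V ≤ LinearMap.range f) (not_le_of_gt hUV.lt)
        obtain ⟨z, hz⟩ := h ⟨v, hv, rfl⟩
        have hzker : z ∈ LinearMap.ker p := hp.le_ker htop ⟨v, hv, hz.symm⟩
        have h1 := hF' ⟨z, hzker⟩
        have h2 : v = f' ⟨z, hzker⟩ := hφ (hz.symm.trans h1)
        rw [h2]
        exact hf'range _
  obtain ⟨h, hh⟩ := exists_comp_eq_of_range_le φ hφ F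
    (hrange.trans (LinearMap.map_le_range))
  refine ⟨h, LinearMap.ext fun x => hφ ?_⟩
  have h1 : φ (h (q x)) = F (q x) := LinearMap.congr_fun hh _
  have h2 : f' (q x) = f x := LinearMap.congr_fun hf' x
  change φ (h (q x)) = φ (f x)
  rw [h1, hF', h2]

/-- Split Q until the summands are indecomposable, hence uniserial. Projections preserve radicals,
so each component of f stays in a radical and is not onto a nonzero summand. -/
theorem exists_extension (hp : IsProjectiveCover p) (hq : IsProjectiveCover q)
    (hg : Function.Surjective g) (hXY : Interval (B := B) 1 X Y) (n : ℕ) {Q : Type u}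
    [AddCommGroup Q] [Module B Q] [Module.Finite B Q] (hn : Module.length B Q ≤ n)
    (f : P₁ →ₗ[B] Q) (hf : ∀ x, f x ∈ Module.jacobson B Q) :
    ∃ h : P₀ →ₗ[B] Q, h ∘ₗ (LinearMap.ker p).subtype ∘ₗ q = f := by
  induction n generalizing Q with
  | zero =>
    have : Subsingleton Q := Module.length_eq_zero_iff.1 (by simpa using hn)
    exact ⟨0, LinearMap.ext fun x => Subsingleton.elim _ _⟩
  | succ n ih =>
    rcases subsingleton_or_nontrivial Q with hsub | hnt
    · exact ⟨0, LinearMap.ext fun x => Subsingleton.elim _ _⟩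
    by_cases hind : IsIndecomposable B Q
    · refine exists_extension_of_isUniserial hp hq hg hXY
        (NakayamaRing.uniserial (ModuleCat.of B Q) ‹_› hind) f fun htop => ?_
      refine (Module.jacobson_lt_top B Q).ne (eq_top_iff.2 ?_)
      rw [← htop]
      rintro _ ⟨x, rfl⟩
      exact hf x
    · have : ∃ K L : Submodule B Q, IsCompl K L ∧ K ≠ ⊥ ∧ L ≠ ⊥ := by
        by_contra! hcon
        exact hind ⟨hnt, fun K L hKL => or_iff_not_imp_left.2 (hcon K L hKL)⟩
      obtain ⟨K, L, hKL, hK, hL⟩ := this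
      have key : ∀ K L : Submodule B Q, IsCompl K L → L ≠ ⊥ → Module.length B K ≤ n :=
        fun K L hKL hL => by
        have hKtop : K ≠ ⊤ := fun h => hL (by
          have := hKL.inf_eq_bot
          rwa [h, top_inf_eq] at this)
        have h1 := (Submodule.length_lt hKtop).trans_le hn
        exact Order.lt_add_one_iff_of_not_isMax (by simp) |>.1 (by exact_mod_cast h1)
      obtain ⟨h1, hh1⟩ := ih (key K L hKL hL) (K.projectionOnto L hKL ∘ₗ f)
        fun x => Module.le_comap_jacobson (K.projectionOnto L hKL) (hf x)
      obtain ⟨h2, hh2⟩ := ih (key L K hKL.symm hK) (L.projectionOnto K hKL.symm ∘ₗ f)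
        fun x => Module.le_comap_jacobson (L.projectionOnto K hKL.symm) (hf x)
      refine ⟨K.subtype ∘ₗ h1 + L.subtype ∘ₗ h2, LinearMap.ext fun x => ?_⟩
      have e1 := congrArg Subtype.val (LinearMap.congr_fun hh1 x)
      have e2 := congrArg Subtype.val (LinearMap.congr_fun hh2 x)
      refine (congrArg₂ (· + ·) e1 e2).trans ?_
      exact Submodule.projection_add_projection_eq_self hKL (f x)

/-- Thus the transpose is Hom(P₁, W) modulo Hom(P₁, rad W). One direction holds because q lands in
`ker p` = rad P₀, and module maps preserve radicals. -/
theorem mem_range_lcomp_iff_jacobson {C : Type*} {W : Type u} [AddCommGroup W] [Module B W]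
    [Module.Finite B W] [Ring C] [Module C W] [SMulCommClass B C W] (hp : IsProjectiveCover p)
    (hq : IsProjectiveCover q) (hg : Function.Surjective g) (hXY : Interval (B := B) 1 X Y)
    (f : P₁ →ₗ[B] W) :
    f ∈ LinearMap.range (LinearMap.lcomp C W ((LinearMap.ker p).subtype ∘ₗ q)) ↔
      ∀ x, f x ∈ Module.jacobson B W := by
  rw [mem_range_lcomp_iff]
  constructor
  · rintro ⟨h, rfl⟩ x
    refine Module.le_comap_jacobson h ?_
    rw [hp.isUniserial.jacobson_eq hp.surjective]
    exact (q x).2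
  · intro hf
    obtain ⟨n, hn⟩ := ENat.ne_top_iff_exists.1 (Module.length_ne_top (R := B) (M := W))
    exact exists_extension hp hq hg hXY n hn.ge f hf

/-- The transpose of a simple module `X` is simple, and it is annihilated by whatever annihilates
the top `Y` of the radical of the projective cover of `X`. -/
theorem exists_isSimpleModule_tr {C : Type*} {W : Type u} [Ring W] [Module B W] [Ring C]
    [Module C W] [SMulCommClass B C W] (hp : IsProjectiveCover p) (hq : IsProjectiveCover q)
    (e : W ≃ₗ[B] B) (σ : C → B) (hσ : Function.Surjective σ) (heσ : ∀ c w, e (c • w) = e w * σ c) :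
    ∃ Y : ModuleCat.{u} B, IsSimpleModule B Y ∧ Interval (B := B) 1 X Y ∧
      IsSimpleModule C (Tr W B C p q) ∧
      ∀ c, (∀ y : Y, σ c • y = 0) → ∀ t : Tr W B C p q, c • t = 0 := by
  have hfin0 := hp.finite
  obtain ⟨Y, g, hY, hg, hXY⟩ := exists_interval_one hp.isUniserial hp.surjective hp.ker_ne_bot
  have hWfin : Module.Finite B W := Module.Finite.equiv e.symm
  have hWproj : Module.Projective B W := Module.Projective.of_equiv e.symm
  have hcov := hq.comp_simple (hp.isUniserial.of_injective _ (LinearMap.ker p).subtype_injective) hg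
  set y := g ∘ₗ q with hydef
  have hy := hcov.surjective
  have hP1proj := hq.projective
  have hjac : LinearMap.ker y = Module.jacobson B P₁ := (hcov.isUniserial.jacobson_eq hy).symm
  have hmem : ∀ f : P₁ →ₗ[B] W,
      (Submodule.Quotient.mk f : Tr W B C p q) = 0 ↔ ∀ x, f x ∈ Module.jacobson B W := fun f =>
    (Submodule.Quotient.mk_eq_zero _).trans (mem_range_lcomp_iff_jacobson hp hq hg hXY f)
  have hw : ∀ w : W, e w • e.symm 1 = w := fun w => by
    rw [← map_smul, smul_eq_mul, mul_one, e.symm_apply_apply]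
  let Wb := W ⧸ Module.jacobson B W
  have hWb : IsSemisimpleModule B Wb :=
    (IsArtinian.isSemisimpleModule_iff_jacobson B Wb).2 (Module.jacobson_quotient_jacobson B W)
  have hYnt : Nontrivial Y := IsSimpleModule.nontrivial B Y
  obtain ⟨t, ht⟩ := exists_ne (0 : Y)
  have hbar : ∀ f : P₁ →ₗ[B] W, ∃ fb : Y →ₗ[B] Wb, ∀ x, fb (y x) = (Module.jacobson B W).mkQ (f x) :=
    fun f => by
    obtain ⟨fb, hfb⟩ := exists_comp_eq_of_ker_le y hy ((Module.jacobson B W).mkQ ∘ₗ f) (by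
      rw [hjac]
      intro x hx
      exact (Submodule.Quotient.mk_eq_zero _).2 (Module.le_comap_jacobson f hx))
    exact ⟨fb, fun x => LinearMap.congr_fun hfb x⟩
  refine ⟨Y, hY, hXY, ?_, ?_⟩
  · rw [isSimpleModule_iff_toSpanSingleton_surjective]
    constructor
    · let s : Wb →ₗ[B] Y := Submodule.liftQ _ (LinearMap.toSpanSingleton B Y t ∘ₗ e.toLinearMap)
        fun w hw => by
          have := Module.le_comap_jacobson (LinearMap.toSpanSingleton B Y t ∘ₗ e.toLinearMap) hw
          rwa [IsSemisimpleModule.jacobson_eq_bot] at this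
      have hs : Function.Surjective s := fun z => by
        obtain ⟨b, rfl⟩ := IsSimpleModule.toSpanSingleton_surjective B ht z
        exact ⟨Submodule.Quotient.mk (e.symm b), congrArg (· • t) (e.apply_symm_apply b)⟩
      obtain ⟨l, hl⟩ := IsSemisimpleModule.lifting_property s hs LinearMap.id
      obtain ⟨f, hf⟩ := Module.projective_lifting_property (Module.jacobson B W).mkQ (l ∘ₗ y)
        (Submodule.mkQ_surjective _)
      refine ⟨⟨Submodule.Quotient.mk f, 0, fun h0 => ht ?_⟩⟩
      rw [hmem] at h0
      obtain ⟨x, rfl⟩ := hy t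
      have h1 : l (y x) = 0 :=
        (LinearMap.congr_fun hf x).symm.trans ((Submodule.Quotient.mk_eq_zero _).2 (h0 x))
      have h2 : s (l (y x)) = y x := LinearMap.congr_fun hl _
      rw [← h2, h1, map_zero]
    · intro m hm n
      obtain ⟨f, rfl⟩ := Submodule.Quotient.mk_surjective _ m
      obtain ⟨f', rfl⟩ := Submodule.Quotient.mk_surjective _ n
      obtain ⟨fb, hfb⟩ := hbar f
      obtain ⟨fb', hfb'⟩ := hbar f'
      have hfb0 : fb ≠ 0 := fun h0 => hm ((hmem f).2 fun x => by
        rw [← Submodule.Quotient.mk_eq_zero (Module.jacobson B W)]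
        exact (hfb x).symm.trans (by rw [h0]; rfl))
      -- Generation by any nonzero class: modulo radicals, f induces an embedding of Y, so f'
      -- differs from it by an endomorphism of W / rad W. This lifts to an endomorphism of W ≅ B,
      -- which is the action of some c.
      obtain ⟨φ, hφ⟩ := IsSemisimpleModule.extension_property fb
        (LinearMap.injective_of_ne_zero hfb0) fb'
      obtain ⟨Φ, hΦ⟩ := Module.projective_lifting_property (Module.jacobson B W).mkQ
        (φ ∘ₗ (Module.jacobson B W).mkQ) (Submodule.mkQ_surjective _)
      obtain ⟨c, hc⟩ := hσ (e (Φ (e.symm 1)))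
      have hcw : ∀ w, c • w = Φ w := fun w => e.injective (by
        rw [heσ, hc, ← smul_eq_mul, ← map_smul, ← map_smul, hw])
      refine ⟨c, ?_⟩
      rw [LinearMap.toSpanSingleton_apply, ← sub_eq_zero, ← Submodule.Quotient.mk_smul,
        ← Submodule.Quotient.mk_sub, hmem]
      intro x
      rw [← Submodule.Quotient.mk_eq_zero (Module.jacobson B W), LinearMap.sub_apply,
        Submodule.Quotient.mk_sub, sub_eq_zero, LinearMap.smul_apply, hcw]
      have h1 : (Module.jacobson B W).mkQ (Φ (f x)) = φ ((Module.jacobson B W).mkQ (f x)) :=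
        LinearMap.congr_fun hΦ (f x)
      have h2 : φ (fb (y x)) = fb' (y x) := LinearMap.congr_fun hφ (y x)
      refine h1.trans ?_
      rw [← hfb, h2, hfb']
      rfl
  · intro c hc m
    obtain ⟨f, rfl⟩ := Submodule.Quotient.mk_surjective _ m
    rw [← Submodule.Quotient.mk_smul, hmem]
    intro x
    refine Submodule.mem_sInf.2 fun K hK => ?_
    have hKs : IsSimpleModule B (W ⧸ K) := isSimpleModule_iff_isCoatom.2 hK
    -- The composite P₁ → W → W / K induced by `c • f` is x ↦ e(f x) • s. If it is nonzero, W / K is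
    -- isomorphic to the top Y of P₁, so σ c kills W / K and s = 0, a contradiction.
    let s : W ⧸ K := σ c • K.mkQ (e.symm 1)
    let F : P₁ →ₗ[B] (W ⧸ K) := LinearMap.toSpanSingleton B _ s ∘ₗ e.toLinearMap ∘ₗ f
    have hF : F x = K.mkQ (c • f x) := by
      have h1 : c • f x = (e (f x) * σ c) • e.symm 1 := by rw [← heσ, hw]
      rw [h1, mul_smul, map_smul, map_smul]
      rfl
    rw [LinearMap.smul_apply, ← Submodule.Quotient.mk_eq_zero K]
    refine hF.symm.trans ?_
    by_contra hne
    have hF0 : F ≠ 0 := fun h0 => hne (by rw [h0]; rfl)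
    have hFs := LinearMap.surjective_of_ne_zero hF0
    obtain ⟨E⟩ := hcov.isUniserial.equiv_of_surjective y F hy hFs
      (by simp [Module.length_eq_one]) (by simp [Module.length_eq_one])
    have hs0 : s = 0 := by
      obtain ⟨z, hz⟩ := E.surjective (K.mkQ (e.symm 1))
      change σ c • K.mkQ (e.symm 1) = 0
      rw [← hz, ← map_smul, hc, map_zero]
    refine hne ?_
    change e (f x) • s = 0
    rw [hs0, smul_zero]

end Transpose

/-! ### Matlis duality over a commutative artinian ring -/

section Matlis

variable {k : Type v} [CommRing k] [IsArtinianRing k] {E : Type v} [AddCommGroup E] [Module k E]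

theorem IsDualizing.exists_injective (hE : IsDualizing k E) (m : Ideal k) [hm : m.IsMaximal] :
    ∃ f : (k ⧸ m) →ₗ[k] E, Function.Injective f := by
  obtain ⟨i, hi⟩ := hE
  have hss : IsSemisimpleModule k (k ⧸ Ring.jacobson k) :=
    (IsArtinian.isSemisimpleModule_iff_jacobson k _).2 (Module.jacobson_quotient_jacobson k k)
  obtain ⟨l, hl⟩ := IsSemisimpleModule.lifting_property
    (Submodule.factor (Ring.jacobson_le_of_isMaximal m)) (Submodule.factor_surjective _)
    (LinearMap.id : (k ⧸ m) →ₗ[k] (k ⧸ m))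
  exact ⟨i ∘ₗ l, hi.injective.comp (Function.LeftInverse.injective
    (g := Submodule.factor (Ring.jacobson_le_of_isMaximal m)) fun x => LinearMap.congr_fun hl x)⟩

theorem IsDualizing.exists_apply_ne_zero (hE : IsDualizing k E) {V : Type*} [AddCommGroup V]
    [Module k V] {x : V} (hx : x ≠ 0) : ∃ f : V →ₗ[k] E, f x ≠ 0 := by
  have hker : LinearMap.ker (LinearMap.toSpanSingleton k V x) ≠ ⊤ := fun h => hx (by
    have : (1 : k) ∈ LinearMap.ker (LinearMap.toSpanSingleton k V x) := by rw [h]; trivial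
    simpa using this)
  obtain ⟨m, hm, hle⟩ := Ideal.exists_le_maximal _ hker
  obtain ⟨j, hj⟩ := hE.exists_injective m
  obtain ⟨l, hl⟩ := exists_comp_eq_of_ker_le (LinearMap.toSpanSingleton k V x).rangeRestrict
    (LinearMap.surjective_rangeRestrict _) (j ∘ₗ m.mkQ) (by
      rw [LinearMap.ker_rangeRestrict]
      intro r hr
      have : m.mkQ r = 0 := (Submodule.Quotient.mk_eq_zero _).2 (hle hr)
      rw [LinearMap.mem_ker, LinearMap.comp_apply, this, map_zero])
  obtain ⟨i, hi⟩ := hE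
  have := hi.isInjective
  obtain ⟨f, hf⟩ := Module.Injective.extension_property k E _ _ (Submodule.subtype _)
    (Submodule.subtype_injective _) l
  refine ⟨f, fun h0 => ?_⟩
  have h1 : f ((LinearMap.toSpanSingleton k V x).rangeRestrict 1) = j (m.mkQ 1) :=
    (LinearMap.congr_fun hf _).trans (LinearMap.congr_fun hl 1)
  have h2 : f ((LinearMap.toSpanSingleton k V x).rangeRestrict 1) = 0 := by
    rw [← h0]
    exact congrArg f (one_smul k x)
  rw [h2] at h1
  have h3 := hj (h1.symm.trans (map_zero j).symm)
  exact hm.ne_top ((Ideal.eq_top_iff_one m).2 ((Submodule.Quotient.mk_eq_zero m).1 h3))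

/-- By essentiality every map S → E lands in the copy of k / rad k, so it is given by a residue
class r with m r inside rad k, where S ≅ k / m. A nonzero map has r outside m, and inverting r
modulo m yields all other maps as multiples. -/
theorem IsDualizing.isSimpleModule (hE : IsDualizing k E) (S : Type*) [AddCommGroup S]
    [Module k S] [IsSimpleModule k S] : IsSimpleModule k (S →ₗ[k] E) := by
  have hnt : Nontrivial S := IsSimpleModule.nontrivial k S
  obtain ⟨x, hx⟩ := exists_ne (0 : S)
  obtain ⟨f₀, hf₀⟩ := hE.exists_apply_ne_zero hx
  obtain ⟨i, hi⟩ := hE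
  have hmem : ∀ f : S →ₗ[k] E, ∃ r : k, f x = i (Submodule.Quotient.mk r) := fun f => by
    by_cases hf : f = 0
    · exact ⟨0, by rw [hf, LinearMap.zero_apply, Submodule.Quotient.mk_zero, map_zero]⟩
    · have hat := isAtom_range (LinearMap.injective_of_ne_zero hf)
      have hle : LinearMap.range f ≤ LinearMap.range i := by
        rcases hat.le_iff.1 (inf_le_left : LinearMap.range f ⊓ LinearMap.range i ≤ _) with h | h
        · exact absurd (hi.essential _ h) hat.1
        · exact inf_eq_left.1 h
      obtain ⟨z, hz⟩ := hle ⟨x, rfl⟩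
      obtain ⟨r, rfl⟩ := Submodule.Quotient.mk_surjective _ z
      exact ⟨r, hz.symm⟩
  rw [isSimpleModule_iff_toSpanSingleton_surjective]
  refine ⟨⟨⟨f₀, 0, fun h => hf₀ (by rw [h]; rfl)⟩⟩, fun f hf g => ?_⟩
  obtain ⟨r, hr⟩ := hmem f
  obtain ⟨s, hs⟩ := hmem g
  have hmax : Ideal.IsMaximal (LinearMap.ker (LinearMap.toSpanSingleton k S x)) :=
    IsSimpleModule.ker_toSpanSingleton_isMaximal k hx
  set m : Ideal k := LinearMap.ker (LinearMap.toSpanSingleton k S x) with hmdef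
  have hann : ∀ (h : S →ₗ[k] E) (t a : k), h x = i (Submodule.Quotient.mk t) → a ∈ m →
      a * t ∈ Ring.jacobson k := fun h t a ht ha => by
    rw [← Submodule.Quotient.mk_eq_zero (Ring.jacobson k)]
    apply hi.injective
    have ha' : a • x = 0 := ha
    rw [map_zero, ← smul_eq_mul, Submodule.Quotient.mk_smul, map_smul, ← ht, ← map_smul, ha',
      map_zero]
  -- If r lay in m, then r² would lie in rad k, hence also r, because rad k is an intersection of
  -- primes.
  have hrm : r ∉ m := fun hrm => hf (by
    have h1 : r ∈ Ring.jacobson k := by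
      have h2 := hann f r r hr hrm
      rw [Ring.jacobson_eq_sInf_isMaximal] at h2 ⊢
      refine Submodule.mem_sInf.2 fun n hn => ?_
      have hn' : Ideal.IsMaximal n := hn
      exact (hn'.isPrime.mem_or_mem (Submodule.mem_sInf.1 h2 n hn)).elim id id
    rw [(Submodule.Quotient.mk_eq_zero _).2 h1, map_zero] at hr
    by_contra hne
    exact hx (LinearMap.injective_of_ne_zero hne (hr.trans (map_zero f).symm)))
  obtain ⟨u, n, hn, hu⟩ := hmax.exists_inv hrm
  refine ⟨u * s, ?_⟩
  have hx' : f x ≠ 0 := fun h0 => hx (LinearMap.injective_of_ne_zero hf (h0.trans (map_zero f).symm))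
  have key : (u * s) • f x = g x := by
    rw [hr, hs, ← map_smul, ← Submodule.Quotient.mk_smul, smul_eq_mul]
    congr 1
    rw [Submodule.Quotient.eq]
    have h1 := hann g s n hs hn
    have h2 : u * s * r - s = -(n * s) := by linear_combination s * hu
    rw [h2]
    exact neg_mem h1
  refine LinearMap.ext fun y => ?_
  obtain ⟨a, rfl⟩ := IsSimpleModule.toSpanSingleton_surjective k hx y
  change (u * s) • f (a • x) = g (a • x)
  rw [map_smul, map_smul, smul_comm, key]

/-- Exactness of Hom(-, E) reduces to simple modules. The inequality suffices below, since it is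
used for a module and for a submodule of its dual. -/
theorem IsDualizing.length_le (hE : IsDualizing k E) {V : Type*} [AddCommGroup V] [Module k V]
    (hV : IsFiniteLength k V) : Module.length k (V →ₗ[k] E) ≤ Module.length k V := by
  induction hV with
  | @of_subsingleton M _ _ _ =>
    have : Subsingleton (M →ₗ[k] E) := ⟨fun f g => LinearMap.ext fun x => by
      rw [Subsingleton.elim x 0, map_zero, map_zero]⟩
    rw [Module.length_eq_zero]
    exact zero_le
  | @of_simple_quotient M _ _ N hs hN ih =>
    have := hE.isSimpleModule (M ⧸ N)
    obtain ⟨i, hi⟩ := hE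
    have hinj := hi.isInjective
    rw [Module.length_eq_add_of_exact N.subtype N.mkQ N.subtype_injective N.mkQ_surjective
        (LinearMap.exact_subtype_mkQ N),
      Module.length_eq_add_of_exact (LinearMap.lcomp k E N.mkQ) (LinearMap.lcomp k E N.subtype),
      Module.length_eq_one k (M ⧸ N), Module.length_eq_one k ((M ⧸ N) →ₗ[k] E), add_comm]
    · exact add_le_add_left ih 1
    · intro f g hfg
      refine LinearMap.ext fun x => ?_
      obtain ⟨y, rfl⟩ := N.mkQ_surjective x
      exact LinearMap.congr_fun hfg y
    · intro f
      obtain ⟨g, hg⟩ := Module.Injective.extension_property k E _ _ N.subtype N.subtype_injective f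
      exact ⟨g, hg⟩
    · intro f
      constructor
      · intro h
        have hker : LinearMap.ker N.mkQ ≤ LinearMap.ker f := by
          rw [Submodule.ker_mkQ]
          intro x hx
          exact LinearMap.congr_fun h ⟨x, hx⟩
        obtain ⟨l, hl⟩ := exists_comp_eq_of_ker_le N.mkQ N.mkQ_surjective f hker
        exact ⟨l, hl⟩
      · rintro ⟨l, rfl⟩
        refine LinearMap.ext fun x => ?_
        change l (N.mkQ x) = 0
        rw [Submodule.mkQ_apply, (Submodule.Quotient.mk_eq_zero N).2 x.2, map_zero]

theorem IsDualizing.mem_of_forall (hE : IsDualizing k E) {V : Type*} [AddCommGroup V] [Module k V]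
    (N : Submodule k V) {x : V} (h : ∀ f : V →ₗ[k] E, (∀ n ∈ N, f n = 0) → f x = 0) : x ∈ N := by
  by_contra hx
  obtain ⟨f, hf⟩ := hE.exists_apply_ne_zero (x := N.mkQ x)
    fun h0 => hx ((Submodule.Quotient.mk_eq_zero N).1 h0)
  exact hf (h (f ∘ₗ N.mkQ) fun n hn => by
    rw [LinearMap.comp_apply, Submodule.mkQ_apply, (Submodule.Quotient.mk_eq_zero N).2 hn, map_zero])

/-- With N the common kernel of p, V / N embeds in the dual of p. So the dual of V / N, which
contains p, has length at most that of p, and the two coincide. -/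
theorem IsDualizing.mem_dual_of_forall (hE : IsDualizing k E) {V : Type*} [AddCommGroup V]
    [Module k V] (hV : IsFiniteLength k V) (p : Submodule k (V →ₗ[k] E)) {f : V →ₗ[k] E}
    (h : ∀ x, (∀ g ∈ p, g x = 0) → f x = 0) : f ∈ p := by
  let N : Submodule k V := ⨅ g ∈ p, LinearMap.ker g
  have hN : ∀ x, x ∈ N ↔ ∀ g ∈ p, g x = 0 := fun x => by simp [N]
  let R := LinearMap.range (LinearMap.lcomp k E N.mkQ)
  have hR : ∀ g : V →ₗ[k] E, (∀ x ∈ N, g x = 0) → g ∈ R := fun g hg => by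
    obtain ⟨l, hl⟩ := exists_comp_eq_of_ker_le N.mkQ N.mkQ_surjective g (by
      rw [Submodule.ker_mkQ]
      exact hg)
    exact ⟨l, hl⟩
  have hpR : p ≤ R := fun g hg => hR g fun x hx => (hN x).1 hx g hg
  have hfinD : IsFiniteLength k (V →ₗ[k] E) := Module.length_ne_top_iff.1
    (ne_top_of_le_ne_top (Module.length_ne_top_iff.2 hV) (hE.length_le hV))
  have hfinp : IsFiniteLength k p := hfinD.of_injective p.subtype_injective
  have h1 : Module.length k R ≤ Module.length k (V ⧸ N) :=
    (Module.length_le_of_surjective _ (LinearMap.surjective_rangeRestrict _)).trans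
      (hE.length_le (hV.of_surjective N.mkQ_surjective))
  let ev : (V ⧸ N) →ₗ[k] (p →ₗ[k] E) := N.liftQ (LinearMap.flip p.subtype) fun x hx => by
    ext g
    exact (hN x).1 hx g g.2
  have hev : Function.Injective ev := by
    rw [injective_iff_map_eq_zero]
    intro z hz
    obtain ⟨x, rfl⟩ := N.mkQ_surjective z
    exact (Submodule.Quotient.mk_eq_zero N).2 ((hN x).2 fun g hg => LinearMap.congr_fun hz ⟨g, hg⟩)
  have h2 : Module.length k (V ⧸ N) ≤ Module.length k p :=
    (Module.length_le_of_injective ev hev).trans (hE.length_le hfinp)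
  have hbij := bijective_of_injective_of_length_eq (Submodule.inclusion hpR)
    (Submodule.inclusion_injective hpR)
    (le_antisymm (Module.length_le_of_injective _ (Submodule.inclusion_injective hpR))
      (h1.trans h2))
    (ne_top_of_le_ne_top (Module.length_ne_top_iff.2 hfinp) (h1.trans h2))
  obtain ⟨⟨g, hg⟩, hgf⟩ := hbij.2 ⟨f, hR f fun x hx => h x ((hN x).1 hx)⟩
  have : g = f := congrArg Subtype.val hgf
  exact this ▸ hg

theorem exists_isDualizing (k : Type v) [CommRing k] : ∃ E : ModuleCat.{v} k, IsDualizing k E :=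
  let ⟨E, i, hi⟩ := exists_isInjectiveEnvelope (R := k) (k ⧸ Ring.jacobson k)
  ⟨E, i, hi⟩

end Matlis

open MulOpposite

/-! ### Perfect pairings and lattice duality -/

section DualPairs

/-- A perfect pairing between a `B`-module `M` and a `C`-module `M'`, where scalars are moved from
one side to the other along `σ`. -/
structure IsDualPair {B C : Type*} [Ring B] [Ring C] (σ : C → B) {M M' E : Type*} [AddCommGroup M]
    [Module B M] [AddCommGroup M'] [Module C M'] [AddCommGroup E] (β : M' →+ M →+ E) : Prop where
  surjective : Function.Surjective σ
  smul : ∀ c f x, β (c • f) x = β f (σ c • x)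
  mem_left : ∀ (N : Submodule B M) x, (∀ f, (∀ n ∈ N, β f n = 0) → β f x = 0) → x ∈ N
  mem_right : ∀ (K : Submodule C M') f, (∀ x, (∀ g ∈ K, β g x = 0) → β f x = 0) → f ∈ K

/-- The `B`-module `S` and the `C`-module `S'` have the same annihilator, up to `σ`. -/
def SameAnnihilator {B C : Type*} [Ring B] [Ring C] (σ : C → B) (S S' : Type*) [AddCommGroup S]
    [Module B S] [AddCommGroup S'] [Module C S'] : Prop :=
  ∀ c, (∀ s : S, σ c • s = 0) ↔ ∀ s' : S', c • s' = 0

namespace IsDualPair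

variable {B C : Type*} [Ring B] [Ring C] {σ : C → B} {M M' E : Type*} [AddCommGroup M]
  [Module B M] [AddCommGroup M'] [Module C M'] [AddCommGroup E] {β : M' →+ M →+ E}

/-- The orthogonal complement in the dual module. -/
def perp (h : IsDualPair σ β) (N : Submodule B M) : Submodule C M' where
  carrier := {f | ∀ n ∈ N, β f n = 0}
  add_mem' {f g} hf hg n hn := by rw [map_add, AddMonoidHom.add_apply, hf n hn, hg n hn, add_zero]
  zero_mem' n _ := by rw [map_zero, AddMonoidHom.zero_apply]
  smul_mem' c f hf n hn := by rw [h.smul]; exact hf _ (N.smul_mem _ hn)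

/-- The orthogonal complement in the original module. -/
def coperp (h : IsDualPair σ β) (K : Submodule C M') : Submodule B M where
  carrier := {x | ∀ f ∈ K, β f x = 0}
  add_mem' {x y} hx hy f hf := by rw [map_add, hx f hf, hy f hf, add_zero]
  zero_mem' f _ := by rw [map_zero]
  smul_mem' b x hx f hf := by
    obtain ⟨c, rfl⟩ := h.surjective b
    rw [← h.smul]
    exact hx _ (K.smul_mem _ hf)

theorem coperp_perp (h : IsDualPair σ β) (N : Submodule B M) : h.coperp (h.perp N) = N :=
  le_antisymm (fun x hx => h.mem_left N x fun f hf => hx f hf) fun x hx _ hf => hf x hx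

theorem perp_coperp (h : IsDualPair σ β) (K : Submodule C M') : h.perp (h.coperp K) = K :=
  le_antisymm (fun f hf => h.mem_right K f fun x hx => hf x hx) fun f hf _ hx => hx f hf

/-- Taking orthogonal complements reverses the submodule lattice. -/
def orderIso (h : IsDualPair σ β) : Submodule B M ≃o (Submodule C M')ᵒᵈ where
  toFun N := OrderDual.toDual (h.perp N)
  invFun K := h.coperp (OrderDual.ofDual K)
  left_inv := h.coperp_perp
  right_inv := h.perp_coperp
  map_rel_iff' {N N'} := by
    constructor
    · intro hle
      rw [← h.coperp_perp N, ← h.coperp_perp N']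
      exact fun x hx f hf => hx f (hle hf)
    · exact fun hle f hf n hn => hf n (hle hn)

theorem length_eq (h : IsDualPair σ β) : Module.length B M = Module.length C M' := by
  apply WithBot.coe_injective
  rw [Module.coe_length, Module.coe_length, Order.krullDim_eq_of_orderIso h.orderIso,
    Order.krullDim_orderDual]

theorem isUniserial_iff (h : IsDualPair σ β) : IsUniserial B M ↔ IsUniserial C M' := by
  constructor
  · intro hM K L
    rw [← h.perp_coperp K, ← h.perp_coperp L]
    exact (hM (h.coperp L) (h.coperp K)).imp (fun hle f hf n hn => hf n (hle hn))
      (fun hle f hf n hn => hf n (hle hn))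
  · intro hM K L
    rw [← h.coperp_perp K, ← h.coperp_perp L]
    exact (hM (h.perp L) (h.perp K)).imp (fun hle x hx f hf => hx f (hle hf))
      (fun hle x hx f hf => hx f (hle hf))

theorem isSimpleModule (h : IsDualPair σ β) [IsSimpleModule B M] : IsSimpleModule C M' := by
  rw [← Module.length_eq_one_iff, ← h.length_eq, Module.length_eq_one]

theorem nontrivial_iff (h : IsDualPair σ β) : Nontrivial M ↔ Nontrivial M' := by
  rw [← Module.length_pos_iff (R := B), ← Module.length_pos_iff (R := C), h.length_eq]

theorem isIndecomposable (h : IsDualPair σ β) (hM : IsIndecomposable B M) :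
    IsIndecomposable C M' := by
  refine ⟨h.nontrivial_iff.1 hM.1, fun K L hKL => ?_⟩
  have h1 := (OrderIso.isCompl_iff h.orderIso.symm (x := OrderDual.toDual K)
    (y := OrderDual.toDual L)).1 hKL.dual
  have key : ∀ K : Submodule C M', h.orderIso.symm (OrderDual.toDual K) = ⊥ → K = ⊤ := fun K hK => by
    have : OrderDual.toDual K = ⊥ := by rw [← h.orderIso.symm.map_bot] at hK
                                        exact h.orderIso.symm.injective hK
    exact this
  rcases hM.2 _ _ h1 with h2 | h2
  · right
    have := hKL.inf_eq_bot
    rwa [key K h2, top_inf_eq] at this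
  · left
    have := hKL.inf_eq_bot
    rwa [key L h2, inf_top_eq] at this

theorem finite (h : IsDualPair σ β) (hM : IsFiniteLength B M) : Module.Finite C M' := by
  have : IsFiniteLength C M' := Module.length_ne_top_iff.1
    (h.length_eq ▸ Module.length_ne_top_iff.2 hM)
  have := (isFiniteLength_iff_isNoetherian_isArtinian.1 this).1
  infer_instance

theorem eq_zero_right (h : IsDualPair σ β) {f : M'} (hf : ∀ x, β f x = 0) : f = 0 :=
  (Submodule.mem_bot C).1 (h.mem_right ⊥ f fun x _ => hf x)

theorem eq_zero_left (h : IsDualPair σ β) {x : M} (hx : ∀ f, β f x = 0) : x = 0 :=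
  (Submodule.mem_bot B).1 (h.mem_left ⊥ x fun f _ => hx f)

theorem sameAnnihilator (h : IsDualPair σ β) : SameAnnihilator σ M M' := by
  refine fun c => ⟨fun hc f => h.eq_zero_right fun x => ?_, fun hc x => h.eq_zero_left fun f => ?_⟩
  · rw [h.smul, hc, map_zero]
  · rw [← h.smul, hc, map_zero, AddMonoidHom.zero_apply]

theorem isAtom_perp (h : IsDualPair σ β) {N : Submodule B M} (hN : IsCoatom N) :
    IsAtom (h.perp N) :=
  isAtom_dual_iff_isCoatom.1 ((OrderIso.isCoatom_iff h.orderIso N).2 hN).dual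

theorem isCoatom_perp (h : IsDualPair σ β) {N : Submodule B M} (hN : IsAtom N) :
    IsCoatom (h.perp N) :=
  ((OrderIso.isAtom_iff h.orderIso N).2 hN).dual

theorem of_equiv (h : IsDualPair σ β) {M'' : Type*} [AddCommGroup M''] [Module C M'']
    (e : M'' ≃ₗ[C] M') : IsDualPair σ (β.comp e.toLinearMap.toAddMonoidHom) where
  surjective := h.surjective
  smul c f x := by
    change β (e (c • f)) x = β (e f) (σ c • x)
    rw [map_smul, h.smul]
  mem_left N x hx := h.mem_left N x fun f hf => by
    obtain ⟨g, rfl⟩ := e.surjective f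
    exact hx g hf
  mem_right K f hf := by
    have := h.mem_right (K.map e.toLinearMap) (e f) fun x hx => hf x fun g hg => hx _ ⟨g, hg, rfl⟩
    obtain ⟨g, hg, hgf⟩ := this
    exact e.injective hgf ▸ hg

end IsDualPair

theorem SameAnnihilator.congr {B C : Type*} [Ring B] [Ring C] {σ : C → B} {S S' T T' : Type*}
    [AddCommGroup S] [Module B S] [AddCommGroup S'] [Module C S'] [AddCommGroup T] [Module B T]
    [AddCommGroup T'] [Module C T'] (h : SameAnnihilator σ S S') (e : S ≃ₗ[B] T)
    (e' : S' ≃ₗ[C] T') : SameAnnihilator σ T T' := by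
  intro c
  have h1 : (∀ t : T, σ c • t = 0) ↔ ∀ s : S, σ c • s = 0 :=
    e.surjective.forall.trans (forall_congr' fun s => by rw [← map_smul, e.map_eq_zero_iff])
  have h2 : (∀ t : T', c • t = 0) ↔ ∀ s : S', c • s = 0 :=
    e'.surjective.forall.trans (forall_congr' fun s => by rw [← map_smul, e'.map_eq_zero_iff])
  rw [h1, h2]
  exact h c

/-- Duality reverses intervals. -/
theorem Interval.dual {B C : Type u} [Ring B] [Ring C] [IsArtinianRing C] {σ : C → B}
    (hdual : ∀ U : ModuleCat.{u} B, IsFiniteLength B U → ∃ (U' : ModuleCat.{u} C)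
      (E : Type v) (_ : AddCommGroup E) (β : U' →+ U →+ E), IsDualPair σ β)
    {S T S' T' : Type*} [AddCommGroup S] [Module B S] [IsSimpleModule B S] [AddCommGroup T]
    [Module B T] [IsSimpleModule B T] [AddCommGroup S'] [Module C S'] [IsSimpleModule C S']
    [AddCommGroup T'] [Module C T'] [IsSimpleModule C T'] {m : ℕ}
    (h : Interval (B := B) m S T) (hS : SameAnnihilator σ S S') (hT : SameAnnihilator σ T T') :
    Interval (B := C) m T' S' := by
  obtain ⟨U, p, i, hU, hl, hp, hi⟩ := h
  obtain ⟨U', E, _, β, hβ⟩ := hdual U (Module.length_ne_top_iff.1 (by rw [hl]; simp))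
  have hat := hβ.isAtom_perp (LinearMap.isCoatom_ker_of_surjective hp)
  have hco := hβ.isCoatom_perp (isAtom_range hi)
  have h1 : IsSimpleModule C (hβ.perp (LinearMap.ker p)) := isSimpleModule_iff_isAtom.2 hat
  have h2 : IsSimpleModule C (U' ⧸ hβ.perp (LinearMap.range i)) := isSimpleModule_iff_isCoatom.2 hco
  -- The socle of the dual is the complement of rad U. It is killed by everything that kills the top
  -- S, so it must be S'; dually for the top and T'.
  obtain ⟨e⟩ := equiv_of_annihilator_le (R := C) (S := S') (T := hβ.perp (LinearMap.ker p))
    fun c hc f => Subtype.ext (hβ.eq_zero_right fun x => by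
      rw [Submodule.coe_smul, hβ.smul]
      refine f.2 _ ?_
      rw [LinearMap.mem_ker, map_smul]
      exact (hS c).2 hc _)
  obtain ⟨e'⟩ := equiv_of_annihilator_le (R := C) (S := T')
    (T := U' ⧸ hβ.perp (LinearMap.range i)) fun c hc z => by
      obtain ⟨f, rfl⟩ := Submodule.Quotient.mk_surjective _ z
      rw [← Submodule.Quotient.mk_smul, Submodule.Quotient.mk_eq_zero]
      rintro _ ⟨t, rfl⟩
      rw [hβ.smul, ← map_smul, (hT c).2 hc, map_zero, map_zero]
  have hint : Interval (B := C) m (U' ⧸ hβ.perp (LinearMap.range i)) (hβ.perp (LinearMap.ker p)) :=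
    ⟨U', Submodule.mkQ _, Submodule.subtype _, hβ.isUniserial_iff.1 hU, hβ.length_eq ▸ hl,
      Submodule.mkQ_surjective _, Submodule.subtype_injective _⟩
  exact hint.congr e'.symm e.symm

end DualPairs

/-! ### The duality D of an artin algebra -/

section ArtinAlgebras

variable (k : Type v) [CommRing k]

/-- The evaluation pairing of a module with its dual. -/
def Dual.ev (B : Type*) [Ring B] [Algebra k B] (E : Type*) [AddCommGroup E] [Module k E]
    (M : Type*) [AddCommGroup M] [Module B M] : Dual k B E M →+ M →+ E :=
  AddMonoidHom.mk' (fun f => (show RestrictScalars k B M →ₗ[k] E from f).toAddMonoidHom.comp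
    (RestrictScalars.addEquiv k B M).symm.toAddMonoidHom) fun _ _ => rfl

variable {k} [IsArtinianRing k]

theorem isFiniteLength_of_finite (B : Type*) [Ring B] [Algebra k B] [Module.Finite k B]
    (M : Type*) [AddCommGroup M] [Module B M] [Module.Finite B M] [Module k M]
    [IsScalarTower k B M] : IsFiniteLength k M := by
  have : Module.Finite k M := Module.Finite.trans B M
  exact isFiniteLength_iff_isNoetherian_isArtinian.2 ⟨inferInstance, inferInstance⟩

theorem IsDualizing.isDualPair {E : Type v} [AddCommGroup E] [Module k E] (hE : IsDualizing k E)
    {B C : Type*} [Ring B] [Algebra k B] [Module.Finite k B] [Ring C] {M : Type*} [AddCommGroup M]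
    [Module B M] [Module.Finite B M] [Module k M] [IsScalarTower k B M] {M' : Type*}
    [AddCommGroup M'] [Module C M'] (β : M' →+ M →+ E)
    (hβ : ∀ f (r : k) x, β f (r • x) = r • β f x)
    (hβ' : ∀ g : M →ₗ[k] E, ∃ f, ∀ x, β f x = g x) (hβ'' : ∀ f, (∀ x, β f x = 0) → f = 0)
    {σ : C → B} (hσ : Function.Surjective σ)
    (hsmul : ∀ (c : C) f x, β (c • f) x = β f (σ c • x)) : IsDualPair σ β where
  surjective := hσ
  smul := hsmul
  mem_left N x hx := hE.mem_of_forall (N.restrictScalars k) fun g hg => by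
    obtain ⟨f, hf⟩ := hβ' g
    rw [← hf]
    exact hx f fun n hn => (hf n).trans (hg n hn)
  mem_right K f hf := by
    let L (f : M') : M →ₗ[k] E := { toFun := β f, map_add' := map_add _, map_smul' := hβ f }
    let K' : Submodule k (M →ₗ[k] E) :=
      { carrier := {g | ∃ f ∈ K, L f = g}
        add_mem' := by
          rintro _ _ ⟨f, hf, rfl⟩ ⟨g, hg, rfl⟩
          refine ⟨f + g, K.add_mem hf hg, LinearMap.ext fun x => ?_⟩
          change β (f + g) x = β f x + β g x
          rw [map_add, AddMonoidHom.add_apply]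
        zero_mem' := ⟨0, K.zero_mem, LinearMap.ext fun x => by
          change β 0 x = 0
          rw [map_zero, AddMonoidHom.zero_apply]⟩
        smul_mem' := by
          rintro r _ ⟨f, hf, rfl⟩
          -- K is only assumed stable under C. Scalars from k act through B, and so through C, by
          -- surjectivity of σ.
          obtain ⟨c, hc⟩ := hσ (algebraMap k B r)
          refine ⟨c • f, K.smul_mem c hf, LinearMap.ext fun x => ?_⟩
          change β (c • f) x = r • β f x
          rw [hsmul, hc, algebraMap_smul, hβ] }
    obtain ⟨g, hg, hgf⟩ := hE.mem_dual_of_forall (isFiniteLength_of_finite B M) K' (f := L f)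
      fun x hx => hf x fun g hg => hx (L g) ⟨g, hg, rfl⟩
    have : g - f = 0 := hβ'' _ fun x => by
      rw [map_sub, AddMonoidHom.sub_apply, sub_eq_zero]
      exact LinearMap.congr_fun hgf x
    rwa [← sub_eq_zero.1 this]

theorem IsDualizing.isDualPair_ev {E : Type v} [AddCommGroup E] [Module k E]
    (hE : IsDualizing k E) {B C : Type*} [Ring B] [Algebra k B] [Module.Finite k B] [Ring C]
    {M : Type*} [AddCommGroup M] [Module B M] [Module.Finite B M] [Module C (Dual k B E M)]
    {σ : C → B} (hσ : Function.Surjective σ)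
    (hsmul : ∀ (c : C) f x, Dual.ev k B E M (c • f) x = Dual.ev k B E M f (σ c • x)) :
    IsDualPair σ (Dual.ev k B E M) := by
  let _ : Module k M := Module.compHom M (algebraMap k B)
  have : IsScalarTower k B M := ⟨fun r b x => by rw [Algebra.smul_def, mul_smul]; rfl⟩
  refine hE.isDualPair _ (fun f r x => ?_) (fun g => ?_) (fun f hf => ?_) hσ hsmul
  · exact LinearMap.map_smul (show RestrictScalars k B M →ₗ[k] E from f) r
      ((RestrictScalars.addEquiv k B M).symm x)
  · let f : RestrictScalars k B M →ₗ[k] E :=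
      { toFun := fun x => g (RestrictScalars.addEquiv k B M x)
        map_add' := fun x y => by rw [map_add, map_add]
        map_smul' := fun r x => by
          rw [RestrictScalars.addEquiv_map_smul]
          exact g.map_smul r (RestrictScalars.addEquiv k B M x) }
    exact ⟨f, fun x => rfl⟩
  · exact LinearMap.ext fun x => hf (RestrictScalars.addEquiv k B M x)

variable {A : Type u} [Ring A] [Algebra k A] [Module.Finite k A] {E : Type v} [AddCommGroup E]
  [Module k E]

theorem IsDualizing.isDualPair_left (hE : IsDualizing k E) (M : Type*) [AddCommGroup M]
    [Module A M] [Module.Finite A M] : IsDualPair (unop : Aᵐᵒᵖ → A) (Dual.ev k A E M) :=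
  hE.isDualPair_ev unop_surjective fun _ _ _ => rfl

instance finite_mulOpposite : Module.Finite k Aᵐᵒᵖ :=
  Module.Finite.equiv (MulOpposite.opLinearEquiv k)

theorem IsDualizing.isDualPair_right (hE : IsDualizing k E) (M : Type*) [AddCommGroup M]
    [Module Aᵐᵒᵖ M] [Module.Finite Aᵐᵒᵖ M] :
    IsDualPair (op : A → Aᵐᵒᵖ) (Dual.ev k Aᵐᵒᵖ E M) :=
  hE.isDualPair_ev op_surjective fun _ _ _ => rfl

theorem isArtinianRing_of_finite (k : Type*) [CommRing k] [IsArtinianRing k] (B : Type*) [Ring B] [Algebra k B] [Module.Finite k B] :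
    IsArtinianRing B := isArtinian_of_tower k inferInstance

/-- The dual lives in another universe, but it is finitely generated and can be shrunk to that of A.
-/
theorem exists_isDualPair_left (k : Type v) [CommRing k] [IsArtinianRing k] {A : Type u} [Ring A]
    [Algebra k A] [Module.Finite k A] (M : ModuleCat.{u} A) (hM : IsFiniteLength A M) :
    ∃ (M' : ModuleCat.{u} Aᵐᵒᵖ) (E : Type v) (_ : AddCommGroup E) (β : M' →+ M →+ E),
      IsDualPair (unop : Aᵐᵒᵖ → A) β := by
  have := (isFiniteLength_iff_isNoetherian_isArtinian.1 hM).1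
  obtain ⟨E, hE⟩ := exists_isDualizing k
  have h : IsDualPair (unop : Aᵐᵒᵖ → A) (Dual.ev k A E M) := hE.isDualPair_left M
  have := h.finite hM
  have : Small.{u} (Dual k A E M) := Module.Finite.small Aᵐᵒᵖ _
  exact ⟨ModuleCat.of Aᵐᵒᵖ (Shrink.{u} (Dual k A E M)), E, inferInstance, _,
    h.of_equiv (Shrink.linearEquiv.{u} Aᵐᵒᵖ (Dual k A E M))⟩

theorem exists_isDualPair_right (k : Type v) [CommRing k] [IsArtinianRing k] {A : Type u} [Ring A]
    [Algebra k A] [Module.Finite k A] (M : ModuleCat.{u} Aᵐᵒᵖ) (hM : IsFiniteLength Aᵐᵒᵖ M) :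
    ∃ (M' : ModuleCat.{u} A) (E : Type v) (_ : AddCommGroup E) (β : M' →+ M →+ E),
      IsDualPair (op : A → Aᵐᵒᵖ) β := by
  have := (isFiniteLength_iff_isNoetherian_isArtinian.1 hM).1
  obtain ⟨E, hE⟩ := exists_isDualizing k
  have h : IsDualPair (op : A → Aᵐᵒᵖ) (Dual.ev k Aᵐᵒᵖ E M) := hE.isDualPair_right M
  have := h.finite hM
  have : Small.{u} (Dual k Aᵐᵒᵖ E M) := Module.Finite.small A _
  exact ⟨ModuleCat.of A (Shrink.{u} (Dual k Aᵐᵒᵖ E M)), E, inferInstance, _,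
    h.of_equiv (Shrink.linearEquiv.{u} A (Dual k Aᵐᵒᵖ E M))⟩

end ArtinAlgebras

/-! ### The opposite algebra -/

section Opposite

theorem Interval.not_projective {B : Type u} [Ring B] {S T : Type*} [AddCommGroup S] [Module B S]
    [AddCommGroup T] [Module B T] [IsSimpleModule B S] (h : Interval (B := B) 1 S T) :
    ¬ Module.Projective B S := fun hS => by
  obtain ⟨U, p, i, hU, hl, hp, hi⟩ := h
  obtain ⟨s, hs⟩ := Module.projective_lifting_property p LinearMap.id hp
  have : Nontrivial S := IsSimpleModule.nontrivial B S
  obtain ⟨x, hx⟩ := exists_ne (0 : S)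
  have hps : p (s x) = x := LinearMap.congr_fun hs x
  have hsurj : Function.Surjective s :=
    LinearMap.range_eq_top.1 (hU.eq_top_of_notMem hp ⟨x, rfl⟩ (by rwa [hps]))
  have := Module.length_le_of_surjective s hsurj
  rw [hl, Module.length_eq_one] at this
  exact absurd this (by decide)

theorem IsCyclicNakayama.nakayamaRing (k : Type v) [CommRing k] [IsArtinianRing k] (A : Type u)
    [Ring A] [Algebra k A] [Module.Finite k A]
    (hA : IsCyclicNakayama A) : NakayamaRing A where
  isArtinianRing := isArtinianRing_of_finite k A
  uniserial M h1 h2 := (hA.nakayama M h1 h2).isUniserial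
  not_projective := hA.no_simple_projective

theorem exists_sameAnnihilator_left (k : Type v) [CommRing k] [IsArtinianRing k] (A : Type u)
    [Ring A] [Algebra k A] [Module.Finite k A] [IsArtinianRing A] (S : ModuleCat.{u} A)
    (hS : IsSimpleModule A S) : ∃ S' : ModuleCat.{u} Aᵐᵒᵖ, IsSimpleModule Aᵐᵒᵖ S' ∧
      SameAnnihilator (unop : Aᵐᵒᵖ → A) S S' := by
  obtain ⟨S', E, _, β, hβ⟩ := exists_isDualPair_left k S
    (Module.length_ne_top_iff.1 (by simp [Module.length_eq_one]))
  exact ⟨S', hβ.isSimpleModule, hβ.sameAnnihilator⟩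

theorem exists_sameAnnihilator_right (k : Type v) [CommRing k] [IsArtinianRing k] (A : Type u)
    [Ring A] [Algebra k A] [Module.Finite k A] [IsArtinianRing A] (S : ModuleCat.{u} Aᵐᵒᵖ)
    (hS : IsSimpleModule Aᵐᵒᵖ S) : ∃ S' : ModuleCat.{u} A, IsSimpleModule A S' ∧
      SameAnnihilator (op : A → Aᵐᵒᵖ) S S' := by
  obtain ⟨S', E, _, β, hβ⟩ := exists_isDualPair_right k S
    (Module.length_ne_top_iff.1 (by simp [Module.length_eq_one]))
  exact ⟨S', hβ.isSimpleModule, hβ.sameAnnihilator⟩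

theorem SameAnnihilator.op_symm {A : Type*} [Ring A] {S S' : Type*} [AddCommGroup S] [Module Aᵐᵒᵖ S] [AddCommGroup S']
    [Module A S'] (h : SameAnnihilator (op : A → Aᵐᵒᵖ) S S') :
    SameAnnihilator (unop : Aᵐᵒᵖ → A) S' S := fun c => (h (unop c)).symm

theorem SameAnnihilator.unop_symm {A : Type*} [Ring A] {S S' : Type*} [AddCommGroup S] [Module A S] [AddCommGroup S']
    [Module Aᵐᵒᵖ S'] (h : SameAnnihilator (unop : Aᵐᵒᵖ → A) S S') :
    SameAnnihilator (op : A → Aᵐᵒᵖ) S' S := fun c => (h (op c)).symm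

/-- Duality preserves indecomposability and uniseriality. By surjectivity of τ, the dual of a simple
right module is the socle of a uniserial module of length two; dualizing puts the simple right
module on top of one, so it is not projective. -/
theorem nakayamaRing_mulOpposite (k : Type v) [CommRing k] [IsArtinianRing k] (A : Type u)
    [Ring A] [Algebra k A] [Module.Finite k A]
    [NakayamaRing A] : NakayamaRing Aᵐᵒᵖ := by
  have hart : IsArtinianRing Aᵐᵒᵖ := isArtinianRing_of_finite k Aᵐᵒᵖ
  refine ⟨hart, fun M hM hind => ?_, fun M hM hproj => ?_⟩
  · have hfin : IsFiniteLength Aᵐᵒᵖ M :=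
      isFiniteLength_iff_isNoetherian_isArtinian.2 ⟨inferInstance, inferInstance⟩
    obtain ⟨M', E, _, β, hβ⟩ := exists_isDualPair_right k M hfin
    exact hβ.isUniserial_iff.2 (NakayamaRing.uniserial M' (hβ.finite hfin)
      (hβ.isIndecomposable hind))
  · obtain ⟨M', hM', hann⟩ := exists_sameAnnihilator_right k A M hM
    obtain ⟨e⟩ := out_clsOf M' hM'
    obtain ⟨S, hS⟩ := (translation A).surjective (clsOf M' hM')
    have hint : Interval (B := A) 1 S.out.1 M' :=
      Interval.congr (hS ▸ classInterval_translation S) (LinearEquiv.refl _ _) e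
    obtain ⟨S', hS', hann'⟩ := exists_sameAnnihilator_left k A S.out.1 S.out.2
    exact (hint.dual (exists_isDualPair_left k) hann' hann.op_symm).not_projective hproj

end Opposite

/-! ### Auslander-Reiten translates of simple modules; formulas for γ and ψ -/

section Translates

variable (k : Type v) [CommRing k] [IsArtinianRing k] {A : Type u} [Ring A] [Algebra k A]
  [Module.Finite k A] [NakayamaRing A]

/-- The transpose is simple and killed by the annihilator of Y; so is its dual, now as a left
module, and annihilators determine simple modules. -/
theorem exists_equiv_dual_tr {M : Type u} [AddCommGroup M] [Module A M] [IsSimpleModule A M]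
    {E : Type v} [AddCommGroup E] [Module k E] (hE : IsDualizing k E) {P₀ P₁ : Type u}
    [AddCommGroup P₀] [Module A P₀] [AddCommGroup P₁] [Module A P₁] {p : P₀ →ₗ[A] M}
    {q : P₁ →ₗ[A] LinearMap.ker p} (hp : IsProjectiveCover p) (hq : IsProjectiveCover q) :
    ∃ Y : ModuleCat.{u} A, IsSimpleModule A Y ∧ Interval (B := A) 1 M Y ∧
      Nonempty (Y ≃ₗ[A] Dual k Aᵐᵒᵖ E (Tr A A Aᵐᵒᵖ p q)) := by
  obtain ⟨Y, hY, hMY, hTr, hann⟩ := exists_isSimpleModule_tr (C := Aᵐᵒᵖ) (W := A) hp hq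
    (LinearEquiv.refl A A) unop unop_surjective fun _ _ => rfl
  have hpair : IsDualPair (op : A → Aᵐᵒᵖ) (Dual.ev k Aᵐᵒᵖ E (Tr A A Aᵐᵒᵖ p q)) :=
    hE.isDualPair_right _
  have hs := hpair.isSimpleModule
  exact ⟨Y, hY, hMY, equiv_of_annihilator_le fun c hc =>
    (hpair.sameAnnihilator c).1 (hann (op c) hc)⟩

theorem isTau_iff {M N : Type u} [AddCommGroup M] [Module A M] [IsSimpleModule A M]
    [AddCommGroup N] [Module A N] [IsSimpleModule A N] :
    IsTau k (A := A) M N ↔ Interval (B := A) 1 M N := by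
  constructor
  · rintro ⟨E, P₀, P₁, p, q, hE, hp, hq, ⟨e⟩⟩
    obtain ⟨Y, hY, hMY, ⟨e'⟩⟩ := exists_equiv_dual_tr k hE hp hq
    exact hMY.congr (LinearEquiv.refl _ _) (e'.trans e.symm)
  · intro h
    obtain ⟨E, hE⟩ := exists_isDualizing k
    obtain ⟨P₀, p, hp⟩ := exists_isProjectiveCover (R := A) M
    have := hp.finite
    obtain ⟨P₁, q, hq⟩ := exists_isProjectiveCover (R := A) (LinearMap.ker p)
    obtain ⟨Y, hY, hMY, ⟨e'⟩⟩ := exists_equiv_dual_tr k hE hp hq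
    obtain ⟨e⟩ := h.right_unique hMY
    exact ⟨E, P₀, P₁, p, q, hE, hp, hq, ⟨e.trans e'⟩⟩

theorem exists_equiv_tr {M : Type u} [AddCommGroup M] [Module A M] [IsSimpleModule A M]
    {E : Type v} [AddCommGroup E] [Module k E] (hE : IsDualizing k E) {P₀ P₁ : Type u}
    [AddCommGroup P₀] [Module Aᵐᵒᵖ P₀] [AddCommGroup P₁] [Module Aᵐᵒᵖ P₁]
    {p : P₀ →ₗ[Aᵐᵒᵖ] Dual k A E M} {q : P₁ →ₗ[Aᵐᵒᵖ] LinearMap.ker p} (hp : IsProjectiveCover p)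
    (hq : IsProjectiveCover q) :
    ∃ Y : ModuleCat.{u} A, IsSimpleModule A Y ∧ Interval (B := A) 1 Y M ∧
      Nonempty (Y ≃ₗ[A] Tr A Aᵐᵒᵖ A p q) := by
  have hop := nakayamaRing_mulOpposite k A
  have hpair : IsDualPair (unop : Aᵐᵒᵖ → A) (Dual.ev k A E M) := hE.isDualPair_left _
  have hX := hpair.isSimpleModule
  -- Here A is viewed as the regular module of the opposite ring, so that the transpose computation
  -- applies to D M.
  let e : A ≃ₗ[Aᵐᵒᵖ] Aᵐᵒᵖ :=
    { opAddEquiv with map_smul' := fun _ _ => rfl }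
  obtain ⟨Y, hY, hXY, hTr, hann⟩ := exists_isSimpleModule_tr (C := A) (W := A) hp hq e op
    op_surjective fun _ _ => rfl
  obtain ⟨Y', hY', hYY'⟩ := exists_sameAnnihilator_right k A Y hY
  refine ⟨Y', hY', hXY.dual (exists_isDualPair_right k) hpair.sameAnnihilator.unop_symm hYY',
    equiv_of_annihilator_le fun c hc => hann c ((hYY' c).2 hc)⟩

theorem isTauInv_iff {M N : Type u} [AddCommGroup M] [Module A M] [IsSimpleModule A M]
    [AddCommGroup N] [Module A N] [IsSimpleModule A N] :
    IsTauInv k (A := A) M N ↔ Interval (B := A) 1 N M := by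
  constructor
  · rintro ⟨E, P₀, P₁, p, q, hE, hp, hq, ⟨e⟩⟩
    obtain ⟨Y, hY, hYM, ⟨e'⟩⟩ := exists_equiv_tr k hE hp hq
    exact hYM.congr (e'.trans e.symm) (LinearEquiv.refl _ _)
  · intro h
    have hop := nakayamaRing_mulOpposite k A
    obtain ⟨E, hE⟩ := exists_isDualizing k
    have hpair : IsDualPair (unop : Aᵐᵒᵖ → A) (Dual.ev k A E M) := hE.isDualPair_left _
    have hX := hpair.isSimpleModule
    obtain ⟨P₀, p, hp⟩ := exists_isProjectiveCover (R := Aᵐᵒᵖ) (Dual k A E M)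
    have := hp.finite
    obtain ⟨P₁, q, hq⟩ := exists_isProjectiveCover (R := Aᵐᵒᵖ) (LinearMap.ker p)
    obtain ⟨Y, hY, hYM, ⟨e'⟩⟩ := exists_equiv_tr k hE hp hq
    obtain ⟨e⟩ := h.left_unique hYM
    exact ⟨E, P₀, P₁, p, q, hE, hp, hq, ⟨e.trans e'⟩⟩

/-- The socle of PS lies `projLen S - 1` steps along τ, and the Auslander-Reiten translation adds
one more. -/
theorem isGamma_iff (S T : SimpleClass A) :
    IsGamma k S T ↔ (translation A ^ projLen S) S = T := by
  have key : ∀ Z T : SimpleClass A, (translation A ^ (projLen S - 1)) S = Z →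
      (ClassInterval 1 Z T ↔ (translation A ^ projLen S) S = T) := by
    rintro _ T rfl
    rw [classInterval_one_iff, ← Equiv.Perm.mul_apply, ← pow_succ',
      Nat.sub_add_cancel (projLen_pos S), eq_comm]
  constructor
  · rintro ⟨M, N, P, p, rfl, rfl, hp, -, h⟩
    obtain ⟨hs, hcls⟩ := hp.exists_cls_soc_eq
    have := N.2
    exact (key _ _ hcls.symm).1 ((classInterval_cls (M := ⟨ModuleCat.of A (soc A P), hs⟩)).2
      ((isTau_iff k).1 h))
  · intro h
    obtain ⟨P, p, hp⟩ := exists_isProjectiveCover (R := A) S.out.1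
    obtain ⟨hs, hcls⟩ := hp.exists_cls_soc_eq
    rw [SimpleMod.cls_out] at hcls
    refine ⟨S.out, T.out, P, p, SimpleMod.cls_out S, SimpleMod.cls_out T, hp,
      not_projective_simple _, (isTau_iff k).2 ?_⟩
    rw [← SimpleMod.cls_out T] at h
    exact (classInterval_cls (M := ⟨ModuleCat.of A (soc A P), hs⟩)).1 ((key _ _ hcls.symm).2 h)

theorem isPsi_iff (S T : SimpleClass A) :
    IsPsi k S T ↔ (translation A ^ injLen S) T = S := by
  have key : ∀ Z T : SimpleClass A, (translation A ^ (injLen S - 1)) Z = S →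
      (ClassInterval 1 T Z ↔ (translation A ^ injLen S) T = S) := by
    intro Z T hZ
    rw [classInterval_one_iff, ← (translation A ^ (injLen S - 1)).injective.eq_iff, hZ,
      ← Equiv.Perm.mul_apply, ← pow_succ, Nat.sub_add_cancel (injLen_pos S), eq_comm]
  constructor
  · rintro ⟨M, N, I, i, rfl, rfl, hi, -, h⟩
    obtain ⟨hs, hcls⟩ := hi.exists_cls_top_eq
    have := N.2
    exact (key _ _ hcls).1 ((classInterval_cls (N := ⟨ModuleCat.of A (Top A I), hs⟩)).2
      ((isTauInv_iff k).1 h))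
  · intro h
    obtain ⟨I, i, hi⟩ := exists_isInjectiveEnvelope (R := A) S.out.1
    obtain ⟨hs, hcls⟩ := hi.exists_cls_top_eq
    rw [SimpleMod.cls_out] at hcls
    refine ⟨S.out, T.out, I, i, SimpleMod.cls_out S, SimpleMod.cls_out T, hi,
      not_injective_simple, (isTauInv_iff k).2 ?_⟩
    rw [← SimpleMod.cls_out T] at h
    exact (classInterval_cls (N := ⟨ModuleCat.of A (Top A I), hs⟩)).1 ((key _ _ hcls).2 h)

/-- Duality as a bijection between the simple left and the simple right modules. -/
theorem exists_dualEquiv (k : Type v) [CommRing k] [IsArtinianRing k] (A : Type u) [Ring A]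
    [Algebra k A] [Module.Finite k A] [NakayamaRing A] : ∃ σ : SimpleClass A ≃ SimpleClass Aᵐᵒᵖ,
    ∀ m S T, ClassInterval m S T ↔ ClassInterval m (σ T) (σ S) := by
  have hop := nakayamaRing_mulOpposite k A
  have h1 : ∀ S : SimpleClass A, ∃ S' : SimpleClass Aᵐᵒᵖ,
      SameAnnihilator (unop : Aᵐᵒᵖ → A) S.out.1 S'.out.1 := fun S => by
    obtain ⟨S', hS', h⟩ := exists_sameAnnihilator_left k A S.out.1 S.out.2
    obtain ⟨e⟩ := out_clsOf S' hS'
    exact ⟨clsOf S' hS', h.congr (LinearEquiv.refl _ _) e.symm⟩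
  have h2 : ∀ S' : SimpleClass Aᵐᵒᵖ, ∃ S : SimpleClass A,
      SameAnnihilator (unop : Aᵐᵒᵖ → A) S.out.1 S'.out.1 := fun S' => by
    obtain ⟨S, hS, h⟩ := exists_sameAnnihilator_right k A S'.out.1 S'.out.2
    obtain ⟨e⟩ := out_clsOf S hS
    exact ⟨clsOf S hS, h.op_symm.congr e.symm (LinearEquiv.refl _ _)⟩
  choose σ hσ using h1
  have hinj : Function.Injective σ := fun S T hST => by
    have hS := hσ S
    rw [hST] at hS
    exact eq_of_equiv (equiv_of_annihilator_le fun r hr =>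
      (hσ T (op r)).2 ((hS (op r)).1 hr)).some
  have hsurj : Function.Surjective σ := fun S' => by
    obtain ⟨S, hS⟩ := h2 S'
    exact ⟨S, eq_of_equiv (equiv_of_annihilator_le fun r hr => (hS r).1 ((hσ S r).2 hr)).some⟩
  refine ⟨Equiv.ofBijective σ ⟨hinj, hsurj⟩, fun m S T => ⟨fun h => ?_, fun h => ?_⟩⟩
  · exact Interval.dual (exists_isDualPair_left k) h (hσ S) (hσ T)
  · exact Interval.dual (exists_isDualPair_right k) h (hσ T).unop_symm (hσ S).unop_symm

variable (A)

/-- Reversing intervals exchanges p with q and turns τ into its inverse, so τ^{p(S)} becomes the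
formula for ψ on the opposite side. -/
theorem exists_dualEquiv_isPsi_iff : ∃ σ : SimpleClass A ≃ SimpleClass Aᵐᵒᵖ,
    ∀ S T, IsPsi k (σ S) (σ T) ↔ IsGamma k S T := by
  have hop := nakayamaRing_mulOpposite k A
  obtain ⟨σ, hσ⟩ := exists_dualEquiv k A
  refine ⟨σ, fun S T => ?_⟩
  have hlen : injLen (σ S) = projLen S := by
    unfold injLen projLen
    congr 1
    ext m
    refine not_congr ⟨fun ⟨T', h⟩ => ?_, fun ⟨T, h⟩ => ⟨σ T, (hσ _ _ _).1 h⟩⟩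
    obtain ⟨T, rfl⟩ := σ.surjective T'
    exact ⟨T, (hσ _ _ _).2 h⟩
  have hone : ∀ S, translation Aᵐᵒᵖ (σ (translation A S)) = σ S := fun S =>
    (classInterval_one_iff.1 ((hσ _ _ _).1 (classInterval_translation S))).symm
  have hpow : ∀ n S, (translation Aᵐᵒᵖ ^ n) (σ ((translation A ^ n) S)) = σ S := fun n => by
    induction n with
    | zero => exact fun S => rfl
    | succ n ih =>
      intro S
      rw [pow_succ (translation Aᵐᵒᵖ), pow_succ' (translation A), Equiv.Perm.mul_apply,
        Equiv.Perm.mul_apply, hone, ih]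
  rw [isPsi_iff, isGamma_iff, hlen]
  constructor
  · intro h
    rw [← hpow (projLen S) S] at h
    exact σ.injective ((translation Aᵐᵒᵖ ^ projLen S).injective h).symm
  · rintro rfl
    exact hpow _ S

end Translates

/-! ### Galois connections on orbits, and paths of self-maps -/

section Combinatorics

section Adjoint

variable {X : Type*} (τ : Equiv.Perm X) (p q : X → ℕ)

/-- Two self-maps that move points along the orbits of a permutation, and that lift to a Galois
connection on the integers. -/
theorem iterate_comp_iterate_comp_iterate (hp : ∀ x, 0 < p x) (hq : ∀ x, 0 < q x)
    (h : ∀ x m, m < p x ↔ m < q ((τ ^ m) x)) {ψ γ : X → X} (hγ : ∀ x, (τ ^ p x) x = γ x)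
    (hψ : ∀ x, (τ ^ q x) (ψ x) = x) (t : ℕ) :
    ψ^[t] ∘ γ^[t] ∘ ψ^[t] = ψ^[t] ∧ γ^[t] ∘ ψ^[t] ∘ γ^[t] = γ^[t] := by
  -- Along a ↦ τ^a x these are lifts of γ and ψ to the integers, even if the orbit is finite.
  let F (x : X) (a : ℤ) : ℤ := a + p ((τ ^ a) x)
  let G (x : X) (b : ℤ) : ℤ := b - q ((τ ^ b) x)
  have hF : ∀ x t a, (τ ^ ((F x)^[t] a)) x = γ^[t] ((τ ^ a) x) := fun x t => by
    induction t with
    | zero => exact fun a => rfl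
    | succ t ih =>
      intro a
      rw [Function.iterate_succ_apply, Function.iterate_succ_apply, ih, ← hγ]
      congr 1
      change (τ ^ (a + p ((τ ^ a) x) : ℤ)) x = _
      rw [add_comm, zpow_add, zpow_natCast, Equiv.Perm.mul_apply]
  have hG : ∀ x t a, (τ ^ ((G x)^[t] a)) x = ψ^[t] ((τ ^ a) x) := fun x t => by
    induction t with
    | zero => exact fun a => rfl
    | succ t ih =>
      intro a
      rw [Function.iterate_succ_apply, Function.iterate_succ_apply, ih]
      congr 1
      apply (τ ^ q ((τ ^ a) x)).injective
      rw [hψ, ← zpow_natCast, ← Equiv.Perm.mul_apply, ← zpow_add]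
      congr 2
      change (q ((τ ^ a) x) : ℤ) + (a - q ((τ ^ a) x)) = a
      ring
  have hgc : ∀ x, GaloisConnection (F x) (G x) := fun x a b => by
    change a + (p ((τ ^ a) x) : ℤ) ≤ b ↔ a ≤ b - (q ((τ ^ b) x) : ℤ)
    -- For b < a both inequalities fail by positivity. For b = a + m they read p(τ^a x) ≤ m and
    -- q(τ^{a+m} x) ≤ m, which are equivalent by `h`.
    rcases lt_or_ge b a with hab | hab
    · have := hp ((τ ^ a) x)
      have := hq ((τ ^ b) x)
      omega
    · obtain ⟨m, rfl⟩ := Int.le.dest hab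
      have h1 := h ((τ ^ a) x) m
      rw [← Equiv.Perm.mul_apply, ← zpow_natCast τ m, ← zpow_add, add_comm (m : ℤ) a] at h1
      omega
  have hgct : ∀ x t, GaloisConnection (F x)^[t] (G x)^[t] := fun x t => by
    induction t with
    | zero => exact GaloisConnection.id
    | succ t ih =>
      rw [Function.iterate_succ, Function.iterate_succ']
      exact (hgc x).compose ih
  constructor
  · ext x
    have h1 := congrArg (fun a : ℤ => (τ ^ a) x) ((hgct x t).u_l_u_eq_u 0)
    simp only [hF, hG] at h1
    simpa using h1
  · ext x
    have h1 := congrArg (fun a : ℤ => (τ ^ a) x) ((hgct x t).l_u_l_eq_l 0)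
    simp only [hF, hG] at h1
    simpa using h1

end Adjoint

section PathSup

variable {X Y : Type*}

/-- A path with n + 1 entries takes n steps, hence the strict inequality. Longer paths may be cut at
the front. -/
theorem lt_pathSup_iff (f : X → X) (S : X) (n : ℕ) :
    (n : ℕ∞) < pathSup (fun S T => f S = T) S ↔ S ∈ Set.range f^[n] := by
  have key : ∀ (l : List X) (a : X), (a :: l).IsChain (fun S T => f S = T) →
      (a :: l).getLast? = some S → f^[l.length] a = S := fun l => by
    induction l with
    | nil => intro a _ h; simpa using h
    | cons b l ih =>
      intro a hc hl
      rw [List.isChain_cons_cons] at hc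
      rw [List.length_cons, Function.iterate_succ_apply, hc.1]
      exact ih b hc.2 (by rwa [List.getLast?_cons_cons] at hl)
  have key' : ∀ (n : ℕ) (a : X), ∃ l : List X, (a :: l).IsChain (fun S T => f S = T) ∧
      (a :: l).getLast? = some (f^[n] a) ∧ l.length = n := fun n => by
    induction n with
    | zero => exact fun a => ⟨[], by simp, by simp, rfl⟩
    | succ n ih =>
      intro a
      obtain ⟨l, h1, h2, h3⟩ := ih (f a)
      exact ⟨f a :: l, List.isChain_cons_cons.2 ⟨rfl, h1⟩,
        by rw [List.getLast?_cons_cons, h2, Function.iterate_succ_apply], by simp [h3]⟩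
  unfold pathSup
  simp only [lt_iSup_iff]
  constructor
  · rintro ⟨l, ⟨hc, hl⟩, hn⟩
    cases l with
    | nil => simp at hl
    | cons a l =>
      have hn' : n ≤ l.length := by
        have : n < (a :: l).length := by exact_mod_cast hn
        rw [List.length_cons] at this
        omega
      refine ⟨f^[l.length - n] a, ?_⟩
      rw [← Function.iterate_add_apply, Nat.add_sub_cancel' hn']
      exact key l a hc hl
  · rintro ⟨a, rfl⟩
    obtain ⟨l, h1, h2, h3⟩ := key' n a
    exact ⟨a :: l, ⟨h1, h2⟩, by rw [List.length_cons, h3]; exact_mod_cast n.lt_succ_self⟩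

theorem pathSup_eq_top_iff (f : X → X) (S : X) :
    pathSup (fun S T => f S = T) S = ⊤ ↔ ∀ n, S ∈ Set.range f^[n] := by
  constructor
  · intro h n
    rw [← lt_pathSup_iff, h]
    exact ENat.natCast_lt_top n
  · intro h
    by_contra hne
    obtain ⟨n, hn⟩ := ENat.ne_top_iff_exists.1 hne
    have := (lt_pathSup_iff f S n).2 (h n)
    rw [hn] at this
    exact lt_irrefl _ this

/-- The points with infinitely long paths ending in them. -/
def cyclicPoints (f : X → X) : Set X := {S | pathSup (fun S T => f S = T) S = ⊤}

/-- The maximal length of a path ending in a point with only finitely long ones. -/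
noncomputable def maxPath (f : X → X) : ℕ∞ :=
  ⨆ S ∈ (cyclicPoints f)ᶜ, pathSup (fun S T => f S = T) S

theorem range_iterate_antitone (f : X → X) : Antitone fun n => Set.range f^[n] :=
  antitone_nat_of_succ_le fun n => by
    rintro _ ⟨x, rfl⟩
    exact ⟨f x, rfl⟩

theorem cyclicPoints_subset (f : X → X) (n : ℕ) : cyclicPoints f ⊆ Set.range f^[n] :=
  fun S hS => (pathSup_eq_top_iff f S).1 hS n

/-- The images of the iterates decrease, so on a finite set they become stationary, at the first one
of minimal cardinality. -/
theorem exists_cyclicPoints_eq [Finite X] (f : X → X) :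
    ∃ N, ∀ n, N ≤ n → cyclicPoints f = Set.range f^[n] := by
  obtain ⟨_, ⟨N, rfl⟩, hN⟩ := (wellFounded_lt (α := ℕ)).has_min
    (Set.range fun n => (Set.range f^[n]).ncard) ⟨_, 0, rfl⟩
  have hstab : ∀ n, N ≤ n → Set.range f^[n] = Set.range f^[N] := fun n hn =>
    Set.eq_of_subset_of_ncard_le (range_iterate_antitone f hn)
      (not_lt.1 (hN _ ⟨n, rfl⟩)) (Set.toFinite _)
  refine ⟨N, fun n hn => (cyclicPoints_subset f n).antisymm fun S hS => ?_⟩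
  refine (pathSup_eq_top_iff f S).2 fun m => ?_
  rcases le_total N m with h | h
  · rw [hstab m h, ← hstab n hn]
    exact hS
  · exact range_iterate_antitone f (h.trans hn) hS

/-- The left side asks for a non-cyclic point in the image of the n-th iterate, which contains all
cyclic points. So only cardinalities of images matter. -/
theorem lt_maxPath_iff [Finite X] (f : X → X) (n : ℕ) :
    (n : ℕ∞) < maxPath f ↔ (cyclicPoints f).ncard < (Set.range f^[n]).ncard := by
  unfold maxPath
  simp only [lt_iSup_iff, lt_pathSup_iff]
  constructor
  · rintro ⟨S, hS, hn⟩
    exact Set.ncard_lt_ncard ⟨cyclicPoints_subset f n, fun h => hS (h hn)⟩ (Set.toFinite _)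
  · intro h
    obtain ⟨S, hS, hS'⟩ := Set.exists_mem_notMem_of_ncard_lt_ncard h
    exact ⟨S, hS', hS⟩

theorem maxPath_ne_top [Finite X] (f : X → X) : maxPath f ≠ ⊤ := fun h => by
  obtain ⟨N, hN⟩ := exists_cyclicPoints_eq f
  have := (lt_maxPath_iff f N).1 (h ▸ ENat.natCast_lt_top N)
  rw [hN N le_rfl] at this
  exact lt_irrefl _ this

variable [Finite X] [Finite Y] {f : X → X} {g : Y → Y}

theorem ncard_cyclicPoints_eq
    (h : ∀ n, (Set.range f^[n]).ncard = (Set.range g^[n]).ncard) :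
    (cyclicPoints f).ncard = (cyclicPoints g).ncard := by
  obtain ⟨N, hN⟩ := exists_cyclicPoints_eq f
  obtain ⟨M, hM⟩ := exists_cyclicPoints_eq g
  rw [hN _ (le_max_left N M), hM _ (le_max_right N M), h]

theorem encard_cyclicPoints_eq
    (h : ∀ n, (Set.range f^[n]).ncard = (Set.range g^[n]).ncard) :
    (cyclicPoints f).encard = (cyclicPoints g).encard := by
  rw [← (Set.toFinite (cyclicPoints f)).cast_ncard_eq,
    ← (Set.toFinite (cyclicPoints g)).cast_ncard_eq, ncard_cyclicPoints_eq h]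

theorem maxPath_eq
    (h : ∀ n, (Set.range f^[n]).ncard = (Set.range g^[n]).ncard) :
    maxPath f = maxPath g := by
  have key : ∀ n : ℕ, (n : ℕ∞) < maxPath f ↔ (n : ℕ∞) < maxPath g := fun n => by
    rw [lt_maxPath_iff, lt_maxPath_iff, h, ncard_cyclicPoints_eq h]
  obtain ⟨a, ha⟩ := ENat.ne_top_iff_exists.1 (maxPath_ne_top f)
  obtain ⟨b, hb⟩ := ENat.ne_top_iff_exists.1 (maxPath_ne_top g)
  refine le_antisymm (not_lt.1 fun hlt => ?_) (not_lt.1 fun hlt => ?_)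
  · rw [← hb] at hlt
    exact absurd ((key b).1 hlt) (by rw [← hb]; exact lt_irrefl _)
  · rw [← ha] at hlt
    exact absurd ((key a).2 hlt) (by rw [← ha]; exact lt_irrefl _)

end PathSup

end Combinatorics

/-! ### The invariants in terms of ψ and γ, and the theorem -/

section Main

variable (k : Type v) [CommRing k] (A : Type u) [Ring A] [Algebra k A]

theorem exists_psi [IsArtinianRing k] [Module.Finite k A] [NakayamaRing A] :
    ∃ ψ : SimpleClass A → SimpleClass A, (∀ S, (translation A ^ injLen S) (ψ S) = S) ∧
      ∀ S T, ψ S = T ↔ IsPsi k S T := by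
  refine ⟨fun S => (translation A ^ injLen S).symm S, fun S => Equiv.apply_symm_apply _ _,
    fun S T => ?_⟩
  rw [isPsi_iff, Equiv.symm_apply_eq, eq_comm]

variable {k A}

theorem psiCyclic_eq {ψ : SimpleClass A → SimpleClass A} (h : ∀ S T, ψ S = T ↔ IsPsi k S T) :
    psiCyclic k A = cyclicPoints ψ := by
  have : IsPsi k (A := A) = fun S T => ψ S = T := funext₂ fun S T => propext (h S T).symm
  simp only [psiCyclic, aSimple, cyclicPoints, this]

theorem aAlg_eq {ψ : SimpleClass A → SimpleClass A} (h : ∀ S T, ψ S = T ↔ IsPsi k S T) :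
    aAlg k A = maxPath ψ := by
  have : IsPsi k (A := A) = fun S T => ψ S = T := funext₂ fun S T => propext (h S T).symm
  simp only [aAlg, psiCyclic_eq h, aSimple, maxPath, this]

theorem gammaCyclic_eq {γ : SimpleClass A → SimpleClass A} (h : ∀ S T, γ S = T ↔ IsGamma k S T) :
    gammaCyclic k A = cyclicPoints γ := by
  have : IsGamma k (A := A) = fun S T => γ S = T := funext₂ fun S T => propext (h S T).symm
  simp only [gammaCyclic, aSimple', cyclicPoints, this]

theorem aAlg'_eq {γ : SimpleClass A → SimpleClass A} (h : ∀ S T, γ S = T ↔ IsGamma k S T) :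
    aAlg' k A = maxPath γ := by
  have : IsGamma k (A := A) = fun S T => γ S = T := funext₂ fun S T => propext (h S T).symm
  simp only [aAlg', gammaCyclic_eq h, aSimple', maxPath, this]

end Main

end CyclicNakayama

theorem mainTheorem9 (k : Type v) [CommRing k] [IsArtinianRing k]
    (A : Type u) [Ring A] [Algebra k A] [Module.Finite k A]
    (hA : CyclicNakayama.IsCyclicNakayama A) :
    ∃ ψ γ : CyclicNakayama.SimpleClass A → CyclicNakayama.SimpleClass A,
      (∀ S T, ψ S = T ↔ CyclicNakayama.IsPsi k S T) ∧
      (∀ S T, γ S = T ↔ CyclicNakayama.IsGamma k S T) ∧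
      (∀ t : ℕ, ψ^[t] ∘ γ^[t] ∘ ψ^[t] = ψ^[t] ∧ γ^[t] ∘ ψ^[t] ∘ γ^[t] = γ^[t]) ∧
      (∀ t : ℕ, Set.BijOn γ^[t] (Set.range ψ^[t]) (Set.range γ^[t]) ∧
        Set.InvOn ψ^[t] γ^[t] (Set.range ψ^[t]) (Set.range γ^[t])) ∧
      CyclicNakayama.aAlg k A ≠ ⊤ ∧
      CyclicNakayama.aAlg k A = CyclicNakayama.aAlg k Aᵐᵒᵖ ∧
      CyclicNakayama.aAlg k A = CyclicNakayama.aAlg' k A ∧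
      CyclicNakayama.cAlg k A ≠ ⊤ ∧
      CyclicNakayama.cAlg k A = CyclicNakayama.cAlg' k A ∧
      CyclicNakayama.cAlg k A = CyclicNakayama.cAlg k Aᵐᵒᵖ := by
  open CyclicNakayama in
  have hN := IsCyclicNakayama.nakayamaRing k A hA
  have hop := nakayamaRing_mulOpposite k A
  obtain ⟨ψ, hψ', hψ⟩ := exists_psi k A
  obtain ⟨ψ', -, hψop⟩ := exists_psi k Aᵐᵒᵖ
  let γ (S : SimpleClass A) : SimpleClass A := (translation A ^ projLen S) S
  have hγ : ∀ S T, γ S = T ↔ IsGamma k S T := fun S T => (isGamma_iff k S T).symm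
  have hcomp := iterate_comp_iterate_comp_iterate (translation A) projLen injLen projLen_pos
    injLen_pos lt_projLen_iff_lt_injLen (fun _ => rfl : ∀ S, _ = γ S) hψ'
  have hinv : ∀ t : ℕ, Set.InvOn ψ^[t] γ^[t] (Set.range ψ^[t]) (Set.range γ^[t]) := fun t => by
    constructor
    · rintro _ ⟨x, rfl⟩
      exact congrFun (hcomp t).1 x
    · rintro _ ⟨x, rfl⟩
      exact congrFun (hcomp t).2 x
  have hbij : ∀ t : ℕ, Set.BijOn γ^[t] (Set.range ψ^[t]) (Set.range γ^[t]) := fun t =>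
    (hinv t).bijOn (fun x _ => ⟨x, rfl⟩) fun x _ => ⟨x, rfl⟩
  have hcard : ∀ t : ℕ, (Set.range ψ^[t]).ncard = (Set.range γ^[t]).ncard := fun t => by
    rw [← (hbij t).image_eq, (hbij t).injOn.ncard_image]
  obtain ⟨σ, hσ⟩ := exists_dualEquiv_isPsi_iff k A
  -- Duality carries γ to ψ of the opposite algebra; with `hcard` this compares the images for A and
  -- its opposite.
  have hsemi : Function.Semiconj σ γ ψ' := fun S =>
    ((hψop _ _).2 ((hσ _ _).2 ((hγ _ _).1 rfl))).symm
  have hcard' : ∀ t : ℕ, (Set.range ψ^[t]).ncard = (Set.range ψ'^[t]).ncard := fun t => by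
    have h : Set.range ψ'^[t] = σ '' Set.range γ^[t] := by
      rw [← Set.range_comp, (hsemi.iterate_right t).comp_eq, σ.surjective.range_comp]
    rw [h, Set.ncard_image_of_injective _ σ.injective, hcard]
  refine ⟨ψ, γ, hψ, hγ, hcomp, fun t => ⟨hbij t, hinv t⟩, ?_, ?_, ?_, ?_, ?_, ?_⟩
  · rw [aAlg_eq hψ]
    exact maxPath_ne_top ψ
  · rw [aAlg_eq hψ, aAlg_eq hψop, maxPath_eq hcard']
  · rw [aAlg_eq hψ, aAlg'_eq hγ, maxPath_eq hcard]
  · exact Set.encard_ne_top_iff.2 (Set.toFinite _)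
  · rw [cAlg, cAlg', psiCyclic_eq hψ, gammaCyclic_eq hγ, encard_cyclicPoints_eq hcard]
  · rw [cAlg, cAlg, psiCyclic_eq hψ, psiCyclic_eq hψop, encard_cyclicPoints_eq hcard']
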